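/- Lemma (Improvement of Flatness). Let $n,m\ge 1$, let $\{e_i\}_{i\le n}$ and $\{f^i\}_{i\le m}$ be the canonical bases of $\mathbb R^n$ and $\mathbb R^m$, let $|\cdot|$ be the Euclidean norm, $t^+=\max(t,0)$, and let $B_\rho\subset\mathbb R^n$ be the open ball of radius $\rho$ centered at $0$. For $U:B_1\to\mathbb R^m$ put $\Omega(U)=B_1\cap\{|U|>0\}$ and $F(U)=B_1\cap\partial\Omega(U)$. A function $g$ touches $u$ by below (resp. above) at $x_0$ if $g(x_0)=u(x_0)$ and $g\le u$ (resp. $g\ge u$) in a neighborhood of $x_0$. A continuous $U=(u^1,\dots,u^m):B_1\to\mathbb R^m$ is a viscosity solution in $B_1$ of $\Delta U=0$ in $\Omega(U)$, $|\nabla|U||=1$ on $F(U)$, if each $u^i$ is harmonic in $\Omega(U)$ and, for every $x_0\in F(U)$ and every real function $\varphi$ that is $C^2$ in a neighborhood of $x_0$ with $\nabla\varphi(x_0)\ne0$: (1) if $|\nabla\varphi(x_0)|>1$, then for every unit vector $f\in\mathbb R^m$ the function $\langle U,f\rangle$ is not touched by below by $\varphi$ at $x_0$; (2) if $|\nabla\varphi(x_0)|<1$,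 then $|U|$ is not touched by above by $\varphi^+$ at $x_0$. There are constants $r_0>0$ and $C>0$, depending only on $n$ and $m$, such that for every $0<r\le r_0$ there is $\varepsilon_0>0$, depending only on $r,n,m$, with the following property. Let $0<\varepsilon\le\varepsilon_0$, and let $U$ be a viscosity solution in $B_1$ with $$|U-f^1x_n^+|\le\varepsilon\ \text{ in }B_1,\qquad |U|\equiv0\ \text{ in }B_1\cap\{x_n<-\varepsilon\},\qquad 0\in F(U).$$ Then there are unit vectors $\nu\in\mathbb R^n$ and $\bar f\in\mathbb R^m$ with $|\nu-e_n|\le C\varepsilon$ and $|\bar f-f^1|\le C\varepsilon$ such that $$|U-\bar f\langle x,\nu\rangle^+|\le\varepsilon\tfrac r2\ \text{ in }B_r,\qquad |U|\equiv0\ \text{ in }B_r\cap\{\langle x,\nu\rangle<-\varepsilon\tfrac r2\}.$$ -/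

import Mathlib

open Set Metric Filter Topology InnerProductSpace
open scoped Gradient

noncomputable section

/-- `ℝⁿ` with its Euclidean norm and inner product. -/
abbrev Euc (n : ℕ) : Type := EuclideanSpace ℝ (Fin n)

/-- The positivity set `Ω(U) = Ω ∩ {|U| > 0}`. -/
def positivitySet {n m : ℕ} (Ω : Set (Euc n)) (U : Euc n → Euc m) : Set (Euc n) :=
  {x | x ∈ Ω ∧ 0 < ‖U x‖}

/-- The free boundary `F(U) = Ω ∩ ∂Ω(U)`. -/
def freeBoundary {n m : ℕ} (Ω : Set (Euc n)) (U : Euc n → Euc m) : Set (Euc n) :=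
  Ω ∩ frontier (positivitySet Ω U)

/-- `g` touches `u` by below at `x₀`: they agree at `x₀`, and `g ≤ u` in a neighborhood of `x₀`. -/
def TouchesBelow {n : ℕ} (g u : Euc n → ℝ) (x₀ : Euc n) : Prop :=
  g x₀ = u x₀ ∧ ∀ᶠ x in 𝓝 x₀, g x ≤ u x

/-- `g` touches `u` by above at `x₀`: they agree at `x₀`, and `u ≤ g` in a neighborhood of `x₀`. -/
def TouchesAbove {n : ℕ} (g u : Euc n → ℝ) (x₀ : Euc n) : Prop :=
  g x₀ = u x₀ ∧ ∀ᶠ x in 𝓝 x₀, u x ≤ g x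

/-- Viscosity solutions in `Ω` of the vectorial one-phase problem
`ΔU = 0` in `Ω(U)`, `|∇|U|| = 1` on `F(U)`.

Since `|U| ≥ 0` vanishes on `F(U)`, touching `|U|` by above means touching by the positive part
`φ⁺` of the test function (equivalently `|U| ≤ φ` on the closure of `Ω(U)` near `x₀`): a `φ` with
nonzero gradient is negative somewhere near each of its zeros, so it never lies above `|U|` in a
full neighborhood of a point of `F(U)` at which it vanishes. -/
structure IsViscositySolution {n m : ℕ} (Ω : Set (Euc n)) (U : Euc n → Euc m) : Prop where
  continuousOn : ContinuousOn U Ω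
  harmonic : ∀ i : Fin m, HarmonicOnNhd (fun x => U x i) (positivitySet Ω U)
  not_touched_below : ∀ x₀ ∈ freeBoundary Ω U, ∀ φ : Euc n → ℝ, ContDiffAt ℝ 2 φ x₀ →
    1 < ‖∇ φ x₀‖ → ∀ f : Euc m, ‖f‖ = 1 → ¬ TouchesBelow φ (fun x => inner ℝ (U x) f) x₀
  not_touched_above : ∀ x₀ ∈ freeBoundary Ω U, ∀ φ : Euc n → ℝ, ContDiffAt ℝ 2 φ x₀ →
    ∇ φ x₀ ≠ 0 → ‖∇ φ x₀‖ < 1 → ¬ TouchesAbove (fun x => max (φ x) 0) (fun x => ‖U x‖) x₀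

/-- The last vector `e_n` of the canonical basis of `ℝⁿ`, where `n = d + 1`. -/
def eLast (d : ℕ) : Euc (d + 1) := EuclideanSpace.single (Fin.last d) 1

/-- The first vector `f¹` of the canonical basis of `ℝᵐ`, where `m = k + 1`. -/
def fFirst (k : ℕ) : Euc (k + 1) := EuclideanSpace.single 0 1

end

/-! Linearize at f¹x_n⁺. Where x_n > ε the map U does not vanish, so v = (u¹ - x_n)/ε and the
quotients u^j/ε, j ≠ 1, are harmonic there and bounded by 1. To first order in ε the condition
|∇|U|| = 1 becomes the Neumann condition ∂_n v = 0 on {x_n = 0}, and U = 0 on F(U) becomes a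
Dirichlet condition for u^j/ε. Hence v should be close to a harmonic function even in x_n, with
expansion ⟨x, p⟩ + O(|x|²) at the origin and p tangential, and u^j/ε to an odd one, with expansion
a_j x_n + O(|x|²). So U is close to (x_n + ε⟨x, p⟩)⁺(f¹ + εc), where c collects the a_j. Normalizing
the two vectors costs O(ε²), and for small r the Taylor error A r² is a small fraction of r.

The closeness is quantitative and comes from direct comparison on the ball of radius 1/2, with
neither a Harnack inequality nor a limit of solutions. On the part {x_n ≥ 2δ} of the sphere, v is
cut off towards the equator and extended by parity; the resulting data are Lipschitz with a constant
depending only on n and δ. By Arzelà–Ascoli finitely many harmonic polynomials approximate all such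
data, so the approximant h has C² bounds independent of U (`harmonic_net`,
`exists_symmetric_approx`).

Near the equator h need not resemble v. A corrector c takes care of this: it is large near the
equator of the sphere, yet O(σ) well inside the ball (`exists_equatorial_barrier`,
`exists_isCorrector`). It also makes x_n + ε(h - c) and x_n + ε(h + c) strict sub- and
supersolutions, free boundary condition included. Touching then traps u¹ from below and |U| from
above (`lower_bound_of_approx`, `upper_bound_of_approx`), and the ordinary maximum principle in Ω(U)
handles the other components (`apply_le_of_approx`). Since 0 ∈ F(U), the even approximant is O(σ) at
0.

All barriers are polynomials: the Dirichlet problem on a ball with polynomial data is linear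
algebra, and every estimate follows from the weak maximum principle. -/

noncomputable section
open MvPolynomial

/-! ### Polynomial functions on Euclidean space -/

/-- The function on `ℝⁿ` defined by a polynomial. -/
def peval {n : ℕ} (P : MvPolynomial (Fin n) ℝ) (x : Euc n) : ℝ := eval (fun i => x i) P

/-- The formal Laplacian of a polynomial. -/
def lapP {n : ℕ} : MvPolynomial (Fin n) ℝ →ₗ[ℝ] MvPolynomial (Fin n) ℝ :=
  ∑ i, (pderiv i).toLinearMap ∘ₗ (pderiv i).toLinearMap

variable {n : ℕ}

theorem lapP_apply (P : MvPolynomial (Fin n) ℝ) : lapP P = ∑ i, pderiv i (pderiv i P) := by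
  simp [lapP]

section peval
variable (P Q : MvPolynomial (Fin n) ℝ) (x : Euc n)

@[simp] theorem peval_add : peval (P + Q) x = peval P x + peval Q x := by simp [peval]
@[simp] theorem peval_sub : peval (P - Q) x = peval P x - peval Q x := by simp [peval]
@[simp] theorem peval_neg : peval (-P) x = -peval P x := by simp [peval]
@[simp] theorem peval_mul : peval (P * Q) x = peval P x * peval Q x := by simp [peval]
@[simp] theorem peval_smul (a : ℝ) : peval (a • P) x = a * peval P x := by simp [peval]
@[simp] theorem peval_C (a : ℝ) : peval (C a) x = a := by simp [peval]
@[simp] theorem peval_X (i : Fin n) : peval (X i) x = x i := by simp [peval]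
@[simp] theorem peval_zero : peval (0 : MvPolynomial (Fin n) ℝ) x = 0 := by simp [peval]
@[simp] theorem peval_one : peval (1 : MvPolynomial (Fin n) ℝ) x = 1 := by simp [peval]
@[simp] theorem peval_pow (k : ℕ) : peval (P ^ k) x = peval P x ^ k := by simp [peval]
@[simp] theorem peval_sum {ι : Type*} (s : Finset ι) (f : ι → MvPolynomial (Fin n) ℝ) :
    peval (∑ i ∈ s, f i) x = ∑ i ∈ s, peval (f i) x := by simp [peval]

end peval

theorem hasFDerivAt_peval (P : MvPolynomial (Fin n) ℝ) (x : Euc n) :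
    HasFDerivAt (peval P)
      (∑ i, peval (pderiv i P) x • (EuclideanSpace.proj i : Euc n →L[ℝ] ℝ)) x := by
  induction P using MvPolynomial.induction_on with
  | C a =>
    have : peval (C a : MvPolynomial (Fin n) ℝ) = fun _ => a := by ext; simp
    simpa [this] using hasFDerivAt_const a x
  | add p q hp hq =>
    have : peval (p + q) = fun y => peval p y + peval q y := by ext; simp
    rw [this]
    refine (hp.add hq).congr_fderiv ?_
    rw [← Finset.sum_add_distrib]
    exact Finset.sum_congr rfl fun i _ => by simp [add_smul]
  | mul_X p j hp =>
    have : peval (p * X j) = fun y => peval p y * (EuclideanSpace.proj j : Euc n →L[ℝ] ℝ) y := by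
      ext; simp
    rw [this]
    refine (hp.mul (EuclideanSpace.proj j : Euc n →L[ℝ] ℝ).hasFDerivAt).congr_fderiv ?_
    ext v
    have : ∀ i, peval (pderiv i (p * X j)) x * v i =
        (if i = j then peval p x * v i else 0) + x j * (peval (pderiv i p) x * v i) := fun i => by
      rw [pderiv_mul, pderiv_X]
      by_cases h : i = j
      · subst h; simp; ring
      · simp [h, Ne.symm h]; ring
    simp [sum_apply, Finset.sum_add_distrib, Finset.mul_sum, this, -Derivation.leibniz]

theorem contDiff_peval (P : MvPolynomial (Fin n) ℝ) (k : ℕ∞) : ContDiff ℝ k (peval P) := by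
  induction P using MvPolynomial.induction_on with
  | C a =>
    have : peval (C a : MvPolynomial (Fin n) ℝ) = fun _ => a := by ext; simp
    rw [this]; exact contDiff_const
  | add p q hp hq =>
    have : peval (p + q) = fun y => peval p y + peval q y := by ext; simp
    rw [this]; exact hp.add hq
  | mul_X p j hp =>
    have : peval (p * X j) = fun y => peval p y * (EuclideanSpace.proj j : Euc n →L[ℝ] ℝ) y := by
      ext; simp
    rw [this]; exact hp.mul (ContinuousLinearMap.contDiff _)

theorem contDiffAt_peval (P : MvPolynomial (Fin n) ℝ) (x : Euc n) :
    ContDiffAt ℝ 2 (peval P) x := (contDiff_peval P 2).contDiffAt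

@[fun_prop]
theorem continuous_peval (P : MvPolynomial (Fin n) ℝ) : Continuous (peval P) :=
  (contDiff_peval P 0).continuous

theorem fderiv_peval (P : MvPolynomial (Fin n) ℝ) (x v : Euc n) :
    fderiv ℝ (peval P) x v = ∑ i, peval (pderiv i P) x * v i := by
  rw [(hasFDerivAt_peval P x).fderiv]; simp

theorem gradient_peval_apply (P : MvPolynomial (Fin n) ℝ) (x : Euc n) (i : Fin n) :
    (∇ (peval P) x) i = peval (pderiv i P) x := by
  have h : inner ℝ (∇ (peval P) x) (EuclideanSpace.single i (1 : ℝ)) =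
      fderiv ℝ (peval P) x (EuclideanSpace.single i 1) := by
    rw [gradient, InnerProductSpace.toDual_symm_apply]
  rw [fderiv_peval, EuclideanSpace.inner_single_right] at h
  simpa [Pi.single_apply] using h

theorem norm_gradient_peval_sq (P : MvPolynomial (Fin n) ℝ) (x : Euc n) :
    ‖∇ (peval P) x‖ ^ 2 = ∑ i, peval (pderiv i P) x ^ 2 := by
  rw [EuclideanSpace.norm_sq_eq]
  simp [gradient_peval_apply]

theorem laplacian_peval (P : MvPolynomial (Fin n) ℝ) (x : Euc n) :
    Laplacian.laplacian (peval P) x = peval (lapP P) x := by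
  rw [laplacian_eq_iteratedFDeriv_orthonormalBasis _ (EuclideanSpace.basisFun (Fin n) ℝ),
    lapP_apply, peval_sum]
  refine Finset.sum_congr rfl fun i _ => ?_
  rw [iteratedFDeriv_two_apply]
  have h1 : fderiv ℝ (peval P) = fun y =>
      ∑ j, peval (pderiv j P) y • (EuclideanSpace.proj j : Euc n →L[ℝ] ℝ) := by
    ext1 y; exact (hasFDerivAt_peval P y).fderiv
  have h2 := HasFDerivAt.fun_sum (u := Finset.univ) fun j _ =>
    (hasFDerivAt_peval (pderiv j P) x).smul_const (EuclideanSpace.proj j : Euc n →L[ℝ] ℝ)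
  rw [h1, h2.fderiv]
  simp [sum_apply]

/-! ### The maximum principle -/

/-- Second derivative test. -/
theorem laplacian_nonpos_of_isLocalMax {f : Euc n → ℝ} {x : Euc n} (hf : ContDiffAt ℝ 2 f x)
    (hmax : IsLocalMax f x) : Laplacian.laplacian f x ≤ 0 := by
  rw [laplacian_eq_iteratedFDeriv_orthonormalBasis _ (EuclideanSpace.basisFun (Fin n) ℝ)]
  refine Finset.sum_nonpos fun i _ => ?_
  set e : Euc n := EuclideanSpace.basisFun (Fin n) ℝ i
  by_contra! hpos
  rw [iteratedFDeriv_two_apply] at hpos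
  simp only [Matrix.cons_val_zero, Matrix.cons_val_one] at hpos
  set l : ℝ → Euc n := fun t => x + t • e
  have hl : ∀ t, HasDerivAt l e t := fun t => by
    simpa [l] using ((hasDerivAt_id t).smul_const e).const_add x
  have hl0 : l 0 = x := by simp [l]
  have hlc : ContinuousAt l 0 := (hl 0).continuousAt
  have hlt : Tendsto l (𝓝 0) (𝓝 x) := by simpa [ContinuousAt, hl0] using hlc
  have hd : ∀ᶠ t in 𝓝 (0 : ℝ), deriv (f ∘ l) t = fderiv ℝ f (l t) e := by
    have h1 : ∀ᶠ y in 𝓝 x, DifferentiableAt ℝ f y :=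
      (hf.eventually (by simp)).mono fun y hy => hy.differentiableAt (by simp)
    filter_upwards [hlt.eventually h1] with t ht
    exact (ht.hasFDerivAt.comp_hasDerivAt t (hl t)).deriv
  have hdd : deriv (deriv (f ∘ l)) 0 = fderiv ℝ (fderiv ℝ f) x e e := by
    rw [Filter.EventuallyEq.deriv_eq hd]
    have h2 : DifferentiableAt ℝ (fderiv ℝ f) (l 0) := by
      rw [hl0]
      exact (hf.fderiv_right (m := 1) (by norm_num)).differentiableAt (by simp)
    have h3 := (h2.hasFDerivAt.comp_hasDerivAt 0 (hl 0))
    have h4 := h3.clm_apply (hasDerivAt_const (0 : ℝ) e)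
    simpa [hl0] using h4.deriv
  have hmax' : IsLocalMax (f ∘ l) 0 := by
    simpa [IsLocalMax, IsMaxFilter, hl0] using hlt.eventually hmax
  have hcont : ContinuousAt (f ∘ l) 0 := by
    refine ContinuousAt.comp ?_ hlc
    rw [hl0]; exact hf.continuousAt
  -- A positive second derivative along the line would make the point a local minimum as well, so `f
  -- ∘ l` would be locally constant and its second derivative zero.
  have hmin := isLocalMin_of_deriv_deriv_pos (by rw [hdd]; exact hpos) hmax'.deriv_eq_zero hcont
  have hconst : (f ∘ l) =ᶠ[𝓝 0] fun _ => (f ∘ l) 0 := by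
    filter_upwards [hmax', hmin] with t h1 h2
    exact le_antisymm h1 h2
  have h5 : deriv (f ∘ l) =ᶠ[𝓝 0] fun _ => 0 := by
    refine hconst.deriv.trans ?_
    simp
  rw [h5.deriv_eq] at hdd
  simp at hdd
  linarith

/-- `|x|²` as a polynomial. -/
def sqNormP (n : ℕ) : MvPolynomial (Fin n) ℝ := ∑ i, X i ^ 2

@[simp] theorem peval_sqNormP (x : Euc n) : peval (sqNormP n) x = ‖x‖ ^ 2 := by
  simp [sqNormP, EuclideanSpace.norm_sq_eq]

theorem pderiv_sqNormP (i : Fin n) : pderiv i (sqNormP n) = 2 * X i := by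
  simp [sqNormP, pderiv_X, Pi.single_apply]

theorem lapP_sqNormP : lapP (sqNormP n) = C (2 * (n : ℝ)) := by
  have : (2 : MvPolynomial (Fin n) ℝ) = C 2 := (map_ofNat C 2).symm
  simp only [lapP_apply, pderiv_sqNormP, this, pderiv_C_mul, pderiv_X_self]
  simp [mul_comm]

/-- Weak maximum principle: a function that is subharmonic at the points of a compact set where
it is positive, these being interior, is nonpositive. -/
theorem nonpos_of_subharmonic [NeZero n] {K : Set (Euc n)} (hK : IsCompact K) {f : Euc n → ℝ}
    (hf : ContinuousOn f K)
    (h : ∀ x ∈ K, f x ≤ 0 ∨ (K ∈ 𝓝 x ∧ ContDiffAt ℝ 2 f x ∧ 0 ≤ Laplacian.laplacian f x)) :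
    ∀ x ∈ K, f x ≤ 0 := by
  obtain ⟨B, hB0, hB⟩ : ∃ B : ℝ, 0 < B ∧ ∀ x ∈ K, ‖x‖ ^ 2 ≤ B := by
    obtain ⟨B, hB⟩ := hK.isBounded.exists_norm_le
    refine ⟨B ^ 2 + 1, by positivity, fun x hx => ?_⟩
    have := hB x hx
    nlinarith [norm_nonneg x]
  intro x₀ hx₀
  refine le_of_forall_pos_le_add fun η hη => ?_
  -- Adding δ(|x|² - B) makes the function strictly subharmonic where it is positive, never raises
  -- it on `K`, and lowers it by at most δB = η.
  set δ := η / B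
  have hδ : 0 < δ := by positivity
  set q : MvPolynomial (Fin n) ℝ := δ • (sqNormP n - C B)
  have hq : ∀ x, peval q x = δ * (‖x‖ ^ 2 - B) := fun x => by simp [q]
  have hgc : ContinuousOn (f + peval q) K := hf.add (continuous_peval q).continuousOn
  obtain ⟨x₁, hx₁, hmax⟩ := hK.exists_isMaxOn ⟨x₀, hx₀⟩ hgc
  have key : f x₁ + peval q x₁ ≤ 0 := by
    by_contra! hpos
    have hq1 : peval q x₁ ≤ 0 := by
      rw [hq]; nlinarith [hB x₁ hx₁]
    rcases h x₁ hx₁ with h1 | ⟨hn, hc, hl⟩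
    · linarith
    · have : Laplacian.laplacian (f + peval q) x₁ ≤ 0 :=
        laplacian_nonpos_of_isLocalMax (hc.add (contDiffAt_peval q x₁)) (hmax.isLocalMax hn)
      rw [hc.laplacian_add (contDiffAt_peval q x₁), laplacian_peval] at this
      have e : peval (lapP q) x₁ = δ * (2 * n) := by
        have : lapP (C B : MvPolynomial (Fin n) ℝ) = 0 := by simp [lapP_apply]
        simp only [q, map_smul, map_sub, lapP_sqNormP, this, peval_smul, peval_C, sub_zero]
      have : 0 < δ * (2 * n) := by
        have : 0 < (n : ℝ) := by exact_mod_cast Nat.pos_of_ne_zero (NeZero.ne n)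
        positivity
      linarith
  have h2 := hmax hx₀
  simp only [mem_ofPred_eq, Pi.add_apply] at h2
  have h3 : -η ≤ peval q x₀ := by
    rw [hq]
    have : δ * B = η := by simp only [δ]; field_simp
    nlinarith [sq_nonneg ‖x₀‖]
  linarith

end

noncomputable section
open MvPolynomial
variable {n : ℕ}

/-! ### An interior Lipschitz estimate for harmonic functions -/

theorem laplacian_comp_linearIsometryEquiv (S : Euc n ≃ₗᵢ[ℝ] Euc n) (f : Euc n → ℝ) (x : Euc n) :
    Laplacian.laplacian (f ∘ S) x = Laplacian.laplacian f (S x) := by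
  rw [laplacian_eq_iteratedFDeriv_orthonormalBasis _ (EuclideanSpace.basisFun (Fin n) ℝ),
    laplacian_eq_iteratedFDeriv_orthonormalBasis _ ((EuclideanSpace.basisFun (Fin n) ℝ).map S)]
  refine Finset.sum_congr rfl fun i _ => ?_
  have h := S.toContinuousLinearEquiv.iteratedFDerivWithin_comp_right f
    (uniqueDiffOn_univ (𝕜 := ℝ)) (x := x) (mem_univ _) 2
  rw [preimage_univ, iteratedFDerivWithin_univ, iteratedFDerivWithin_univ] at h
  have h2 : iteratedFDeriv ℝ 2 (f ∘ S) x = _ := h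
  rw [h2, ContinuousMultilinearMap.compContinuousLinearMap_apply]
  congr 1
  ext j
  fin_cases j <;> simp

theorem laplacian_comp_const_add (f : Euc n → ℝ) (c x : Euc n) :
    Laplacian.laplacian (fun y => f (c + y)) x = Laplacian.laplacian f (c + x) := by
  simp only [laplacian_eq_iteratedFDeriv_orthonormalBasis _ (EuclideanSpace.basisFun (Fin n) ℝ),
    iteratedFDeriv_comp_add_left]

/-- The linear form `⟨·, e⟩` as a polynomial. -/
def linP (e : Euc n) : MvPolynomial (Fin n) ℝ := ∑ i, C (e i) * X i

theorem peval_linP (e x : Euc n) : peval (linP e) x = inner ℝ x e := by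
  simp [linP, PiLp.inner_apply]

@[simp] theorem pderiv_linP (e : Euc n) (i : Fin n) : pderiv i (linP e) = C (e i) := by
  simp [linP, pderiv_X, Pi.single_apply]

theorem lapP_linP (e : Euc n) : lapP (linP e) = 0 := by simp [lapP_apply]

theorem lapP_linP_sq (e : Euc n) : lapP (linP e ^ 2) = C (2 * ‖e‖ ^ 2) := by
  have h2 : (2 : MvPolynomial (Fin n) ℝ) = C 2 := (map_ofNat C 2).symm
  simp only [lapP_apply, pderiv_pow, pderiv_linP, EuclideanSpace.norm_sq_eq, Finset.mul_sum,
    map_sum]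
  refine Finset.sum_congr rfl fun i _ => ?_
  simp [h2]
  ring

/-- The difference `v` of u and its reflection across the hyperplane through `c` orthogonal to `e`
vanishes on that hyperplane and is at most 2A. On the half ball it is dominated by the explicit
harmonic quadratic `w`, which is nonnegative on the flat side and at least 2A on the spherical side.
The value of `w` at `t • e` is the bound. -/
theorem harmonic_reflection_estimate [NeZero n] {u : Euc n → ℝ} {c : Euc n} {ρ A : ℝ}
    (hρ : 0 < ρ) (hc : ContinuousOn u (closedBall c ρ)) (hh : HarmonicOnNhd u (ball c ρ))
    (hA : ∀ x ∈ closedBall c ρ, |u x| ≤ A) {e : Euc n} (he : ‖e‖ = 1) {t : ℝ} (ht0 : 0 ≤ t)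
    (htρ : t ≤ ρ) : u (c + t • e) - u (c - t • e) ≤ 2 * n * A * t / ρ := by
  have hA0 : 0 ≤ A := (abs_nonneg _).trans (hA c (mem_closedBall_self hρ.le))
  have hn : (1 : ℝ) ≤ n := by exact_mod_cast Nat.one_le_iff_ne_zero.2 (NeZero.ne n)
  set S : Euc n ≃ₗᵢ[ℝ] Euc n := Submodule.reflection (ℝ ∙ e)ᗮ
  have hSe : S e = -e := Submodule.reflection_orthogonalComplement_singleton_eq_neg e
  have hS0 : ∀ y : Euc n, inner ℝ y e = 0 → S y = y := fun y hy =>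
    Submodule.reflection_mem_subspace_eq_self (Submodule.mem_orthogonal_singleton_iff_inner_left.2 hy)
  set v : Euc n → ℝ := (fun y => u (c + y)) - (fun y => u (c + y)) ∘ S
  set w : MvPolynomial (Fin n) ℝ :=
    (2 * A / ρ ^ 2) • (sqNormP n - (n : ℝ) • linP e ^ 2 + (n * ρ) • linP e)
  have hw : ∀ y, peval w y = (2 * A / ρ ^ 2) *
      (‖y‖ ^ 2 - n * (inner ℝ y e) ^ 2 + n * ρ * inner ℝ y e) := fun y => by
    simp [w, peval_linP]; ring
  have hlw : lapP w = 0 := by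
    simp only [w, map_smul, map_add, map_sub, lapP_sqNormP, lapP_linP_sq, lapP_linP, he]
    simp only [one_pow, smul_zero, add_zero, mul_one, smul_eq_C_mul, ← C_mul, ← C_sub]
    simp; right; ring
  set K : Set (Euc n) := closedBall 0 ρ ∩ {y | 0 ≤ inner ℝ y e}
  have hKc : IsCompact K := (isCompact_closedBall 0 ρ).inter_right
    (isClosed_le continuous_const (by fun_prop))
  have hmem : ∀ y : Euc n, ‖y‖ ≤ ρ → c + y ∈ closedBall c ρ := fun y hy => by simpa using hy
  have hcu : ContinuousOn (fun y => u (c + y)) (closedBall 0 ρ) :=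
    hc.comp (by fun_prop) fun y hy => hmem y (by simpa using hy)
  have hvc : ContinuousOn v K := by
    refine ContinuousOn.sub (hcu.mono inter_subset_left)
      ((hcu.comp S.continuous.continuousOn ?_).mono inter_subset_left)
    intro y hy
    simpa using hy
  have hv2 : ∀ y : Euc n, ‖y‖ ≤ ρ → v y ≤ 2 * A := fun y hy => by
    have h1 := abs_le.1 (hA _ (hmem y hy))
    have h2 := abs_le.1 (hA _ (hmem (S y) (by simpa using hy)))
    simp only [v, Pi.sub_apply, Function.comp_apply]
    linarith
  have hinner : ∀ y : Euc n, inner ℝ y e ≤ ‖y‖ := fun y => by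
    simpa [he] using real_inner_le_norm y e
  have key := nonpos_of_subharmonic hKc (f := v - peval w)
    (hvc.sub (continuous_peval w).continuousOn) (by
    rintro y ⟨hy1, hy2⟩
    have hy1 : ‖y‖ ≤ ρ := by simpa using hy1
    have hy2 : 0 ≤ inner ℝ y e := hy2
    have h3 := hinner y
    rcases hy1.eq_or_lt with h1 | h1
    · left
      have h4 : 2 * A ≤ peval w y := by
        rw [hw, h1, div_mul_eq_mul_div, le_div_iff₀ (by positivity)]
        have : 0 ≤ n * inner ℝ y e * (ρ - inner ℝ y e) := by
          exact mul_nonneg (mul_nonneg (by linarith) hy2) (by linarith)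
        nlinarith
      have := hv2 y hy1
      simp only [Pi.sub_apply]; linarith
    · rcases hy2.eq_or_lt with h2 | h2
      · left
        have h4 : 0 ≤ peval w y := by
          rw [hw, ← h2, show ‖y‖ ^ 2 - n * (0 : ℝ) ^ 2 + n * ρ * 0 = ‖y‖ ^ 2 by ring]
          positivity
        have h5 : v y = 0 := by simp [v, hS0 y h2.symm]
        simp only [Pi.sub_apply]; linarith
      · right
        have hcy : c + y ∈ ball c ρ := by simpa using h1
        have hcs : c + S y ∈ ball c ρ := by simpa using h1
        have hd1 : ∀ z, c + z ∈ ball c ρ → ContDiffAt ℝ 2 (fun y => u (c + y)) z := fun z hz =>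
          (hh _ hz).1.comp z (by fun_prop)
        have hd2 : ContDiffAt ℝ 2 ((fun y => u (c + y)) ∘ S) y :=
          (hd1 (S y) hcs).comp y S.contDiff.contDiffAt
        have hl : ∀ z, c + z ∈ ball c ρ → Laplacian.laplacian (fun y => u (c + y)) z = 0 :=
          fun z hz => by rw [laplacian_comp_const_add]; exact (hh _ hz).2.self_of_nhds
        refine ⟨?_, ((hd1 y hcy).sub hd2).sub (contDiffAt_peval w y), ?_⟩
        · refine inter_mem (closedBall_mem_nhds_of_mem (by simpa using h1)) ?_
          have : IsOpen {y : Euc n | 0 < inner ℝ y e} := isOpen_lt continuous_const (by fun_prop)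
          exact mem_of_superset (this.mem_nhds h2) fun z (hz : 0 < inner ℝ z e) => hz.le
        · have hv : ContDiffAt ℝ 2 v y := (hd1 y hcy).sub hd2
          have hlv : Laplacian.laplacian v y = _ := (hd1 y hcy).laplacian_sub hd2
          rw [hv.laplacian_sub (contDiffAt_peval w y), hlv, laplacian_comp_linearIsometryEquiv,
            hl _ hcy, hl _ hcs, laplacian_peval, hlw]
          simp)
  have hte : inner ℝ (t • e) e = t := by
    rw [real_inner_smul_left, real_inner_self_eq_norm_sq, he]; simp
  have hnt : ‖t • e‖ = t := by rw [norm_smul, he]; simp [abs_of_nonneg ht0]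
  have h1 := key (t • e) ⟨by simpa [hnt] using htρ, by simpa [hte] using ht0⟩
  have h2 : v (t • e) = u (c + t • e) - u (c - t • e) := by
    simp [v, hSe, sub_eq_add_neg]
  simp only [Pi.sub_apply, h2, hw, hte, hnt] at h1
  have h3 : (2 * A / ρ ^ 2) * (t ^ 2 - n * t ^ 2 + n * ρ * t) ≤ 2 * n * A * t / ρ := by
    have : 2 * n * A * t / ρ = (2 * A / ρ ^ 2) * (n * ρ * t) := by field_simp
    rw [this]
    refine mul_le_mul_of_nonneg_left ?_ (by positivity)
    nlinarith [sq_nonneg t]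
  linarith

/-- Interior Lipschitz estimate. -/
theorem harmonic_lipschitz [NeZero n] {u : Euc n → ℝ} {x y : Euc n} {ρ A : ℝ} (hρ : 0 < ρ)
    (hh : HarmonicOnNhd u (closedBall (midpoint ℝ x y) ρ))
    (hA : ∀ z ∈ closedBall (midpoint ℝ x y) ρ, |u z| ≤ A) (hxy : ‖x - y‖ ≤ 2 * ρ) :
    |u x - u y| ≤ n * A / ρ * ‖x - y‖ := by
  wlog h : u y ≤ u x generalizing x y
  · have := this (x := y) (y := x) (by rwa [midpoint_comm]) (by rwa [midpoint_comm])
      (by rwa [norm_sub_rev]) (le_of_not_ge h)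
    rwa [abs_sub_comm, norm_sub_rev]
  rcases eq_or_ne x y with rfl | hne
  · simp
  have hpos : 0 < ‖x - y‖ := norm_pos_iff.2 (sub_ne_zero.2 hne)
  have := harmonic_reflection_estimate hρ (hh.continuousOn) (hh.mono ball_subset_closedBall) hA
    (e := (‖x - y‖)⁻¹ • (x - y)) (by rw [norm_smul]; simp [hpos.ne'])
    (t := ‖x - y‖ / 2) (by positivity) (by linarith)
  have e1 : (‖x - y‖ / 2) • (‖x - y‖)⁻¹ • (x - y) = (1 / 2 : ℝ) • (x - y) := by
    rw [smul_smul]; congr 1; field_simp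
  have e2 : midpoint ℝ x y + (1 / 2 : ℝ) • (x - y) = x := by
    rw [midpoint_eq_smul_add, invOf_eq_inv]; module
  have e3 : midpoint ℝ x y - (1 / 2 : ℝ) • (x - y) = y := by
    rw [midpoint_eq_smul_add, invOf_eq_inv]; module
  rw [e1, e2, e3] at this
  rw [abs_of_nonneg (by linarith)]
  refine this.trans (le_of_eq ?_)
  field_simp

end

noncomputable section
open MvPolynomial
variable {n : ℕ}

/-! ### The Dirichlet problem on balls with polynomial data -/

theorem peval_nonpos_of_sphere [NeZero n] {P : MvPolynomial (Fin n) ℝ} {R : ℝ}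
    (hP : ∀ x ∈ ball (0 : Euc n) R, 0 ≤ peval (lapP P) x)
    (hs : ∀ x ∈ sphere (0 : Euc n) R, peval P x ≤ 0) :
    ∀ x ∈ closedBall (0 : Euc n) R, peval P x ≤ 0 := by
  refine nonpos_of_subharmonic (isCompact_closedBall 0 R) (continuous_peval P).continuousOn ?_
  intro x hx
  rcases (mem_closedBall.1 hx).eq_or_lt with h | h
  · exact Or.inl (hs x h)
  · exact Or.inr ⟨closedBall_mem_nhds_of_mem h, contDiffAt_peval P x,
      by rw [laplacian_peval]; exact hP x h⟩

theorem lapP_C (a : ℝ) : lapP (C a : MvPolynomial (Fin n) ℝ) = 0 := by simp [lapP_apply]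

theorem peval_le_of_sphere [NeZero n] {P : MvPolynomial (Fin n) ℝ} {R A : ℝ} (hP : lapP P = 0)
    (hs : ∀ x ∈ sphere (0 : Euc n) R, peval P x ≤ A) :
    ∀ x ∈ closedBall (0 : Euc n) R, peval P x ≤ A := by
  intro x hx
  have := peval_nonpos_of_sphere (P := P - C A) (R := R) (fun y _ => by simp [hP, lapP_C])
    (fun y hy => by simpa using hs y hy) x hx
  simpa using this

theorem abs_peval_le_of_sphere [NeZero n] {P : MvPolynomial (Fin n) ℝ} {R A : ℝ}
    (hP : lapP P = 0) (hs : ∀ x ∈ sphere (0 : Euc n) R, |peval P x| ≤ A) :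
    ∀ x ∈ closedBall (0 : Euc n) R, |peval P x| ≤ A := by
  intro x hx
  refine abs_le'.2 ⟨peval_le_of_sphere hP (fun y hy => (abs_le'.1 (hs y hy)).1) x hx, ?_⟩
  have := peval_le_of_sphere (P := -P) (R := R) (A := A) (by simp [hP])
    (fun y hy => by simpa using (abs_le'.1 (hs y hy)).2) x hx
  simpa using this

/-- The ball contains a cube, and a polynomial vanishing on a product of infinite sets is zero. Side
R/(n+1) keeps the sum of the coordinates strictly below R. -/
theorem eq_zero_of_peval_eq_zero {P : MvPolynomial (Fin n) ℝ} {R : ℝ} (hR : 0 < R)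
    (h : ∀ x ∈ ball (0 : Euc n) R, peval P x = 0) : P = 0 := by
  have hne : (n : ℝ) + 1 ≠ 0 := by positivity
  refine funext_set (fun _ => Ioo 0 (R / (n + 1))) (fun _ => Ioo_infinite (by positivity)) ?_
  intro x hx
  have := h (WithLp.toLp 2 x) (by
    rw [mem_ball_zero_iff]
    have h1 : ‖WithLp.toLp 2 x‖ ≤ ∑ i, ‖x i‖ := by
      have h2 : (WithLp.toLp 2 x : Euc n) =
          ∑ i, x i • (EuclideanSpace.single i (1 : ℝ) : Euc n) := by
        ext j; simp [Finset.sum_apply, Pi.single_apply]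
      rw [h2]
      refine (norm_sum_le _ _).trans (Finset.sum_le_sum fun i _ => ?_)
      rw [norm_smul]; simp
    have h3 : ∑ i, ‖x i‖ ≤ ∑ _i : Fin n, R / (n + 1) := Finset.sum_le_sum fun i _ => by
      have := hx i (mem_univ i)
      rw [Real.norm_eq_abs, abs_of_pos this.1]; exact this.2.le
    refine (h1.trans h3).trans_lt ?_
    rw [Finset.sum_const, Finset.card_univ, Fintype.card_fin, nsmul_eq_mul, mul_div_assoc',
      div_lt_iff₀ (by positivity)]
    linarith)
  simpa [peval] using this

theorem totalDegree_pderiv_le {P : MvPolynomial (Fin n) ℝ} {N : ℕ} (i : Fin n)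
    (h : P.totalDegree ≤ N + 1) : (pderiv i P).totalDegree ≤ N := by
  rw [totalDegree, Finset.sup_le_iff]
  intro m hm
  rw [mem_support_iff, coeff_pderiv] at hm
  have h1 : m + Finsupp.single i 1 ∈ P.support := by
    rw [mem_support_iff]; exact left_ne_zero_of_mul hm
  have h2 := le_totalDegree h1
  rw [Finsupp.sum_add_index' (fun _ => rfl) (fun _ _ _ => rfl)] at h2
  simp only [Finsupp.sum_single_index] at h2
  omega

theorem totalDegree_lapP_le {P : MvPolynomial (Fin n) ℝ} {N : ℕ}
    (h : P.totalDegree ≤ N + 2) : (lapP P).totalDegree ≤ N := by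
  rw [lapP_apply]
  exact totalDegree_finsetSum_le fun i _ =>
    totalDegree_pderiv_le i (totalDegree_pderiv_le i h)

theorem totalDegree_sqNormP_sub_le (a : ℝ) : (sqNormP n - C a).totalDegree ≤ 2 := by
  refine (totalDegree_sub _ _).trans (max_le ?_ (by simp))
  exact totalDegree_finsetSum_le fun i _ => by simp [totalDegree_X_pow]

/-- The Dirichlet problem on a ball, with polynomial data, has a polynomial solution. -/
theorem exists_harmonic_extension [NeZero n] {R : ℝ} (hR : 0 < R) (p : MvPolynomial (Fin n) ℝ) :
    ∃ q, lapP (p - (sqNormP n - C (R ^ 2)) * q) = 0 := by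
  set N := p.totalDegree
  set Q : MvPolynomial (Fin n) ℝ := sqNormP n - C (R ^ 2)
  -- The operator q ↦ Δ((|x|² - R²)q) does not raise the degree, so it acts on a finite-dimensional
  -- space. If it kills q, then (|x|² - R²)q is harmonic with zero boundary values, hence zero in
  -- the ball. Injectivity gives surjectivity, and Δp is attained.
  set T : MvPolynomial (Fin n) ℝ →ₗ[ℝ] MvPolynomial (Fin n) ℝ := lapP ∘ₗ LinearMap.mulLeft ℝ Q
  have hT : ∀ q ∈ restrictTotalDegree (Fin n) ℝ N, T q ∈ restrictTotalDegree (Fin n) ℝ N := by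
    intro q hq
    rw [mem_restrictTotalDegree] at hq ⊢
    refine totalDegree_lapP_le ((totalDegree_mul _ _).trans ?_)
    have := totalDegree_sqNormP_sub_le (n := n) (R ^ 2)
    have h' : Q.totalDegree ≤ 2 := this
    omega
  have hinj : Function.Injective (T.restrict hT) := by
    rw [← LinearMap.ker_eq_bot, LinearMap.ker_eq_bot']
    rintro ⟨q, hq⟩ h0
    have h0 : lapP (Q * q) = 0 := congrArg Subtype.val h0
    have hz := abs_peval_le_of_sphere (P := Q * q) (R := R) (A := 0) h0 (fun x hx => by
      have : ‖x‖ = R := by simpa using hx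
      simp [Q, this])
    ext1
    refine eq_zero_of_peval_eq_zero hR fun x hx => ?_
    have h1 := abs_nonpos_iff.1 (hz x (ball_subset_closedBall hx))
    rw [peval_mul] at h1
    refine (mul_eq_zero.1 h1).resolve_left ?_
    have : ‖x‖ < R := by simpa using hx
    simp only [Q, peval_sub, peval_sqNormP, peval_C]
    nlinarith [norm_nonneg x]
  have hsurj := LinearMap.injective_iff_surjective.1 hinj
  obtain ⟨⟨q, hq⟩, h⟩ := hsurj ⟨lapP p, by
    rw [mem_restrictTotalDegree]
    exact totalDegree_lapP_le (by omega)⟩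
  refine ⟨q, ?_⟩
  have h : lapP (Q * q) = lapP p := congrArg Subtype.val h
  rw [map_sub, h, sub_self]

/-- Polynomials are dense on the sphere by Stone–Weierstrass, and making one harmonic changes it
only by a multiple of |x|² - R², which is invisible on the sphere. -/
theorem exists_harmonic_near [NeZero n] {R : ℝ} (hR : 0 < R)
    (f : C(sphere (0 : Euc n) R, ℝ)) {δ : ℝ} (hδ : 0 < δ) :
    ∃ P : MvPolynomial (Fin n) ℝ, lapP P = 0 ∧
      ∀ x : sphere (0 : Euc n) R, |peval P x - f x| < δ := by
  set Φ : MvPolynomial (Fin n) ℝ →ₐ[ℝ] C(sphere (0 : Euc n) R, ℝ) :=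
    aeval fun i => ⟨fun x => (x : Euc n) i, by fun_prop⟩
  have hΦ : ∀ P x, Φ P x = peval P (x : Euc n) := by
    intro P x
    induction P using MvPolynomial.induction_on with
    | C a => simp [Φ]
    | add p q hp hq => simp [hp, hq]
    | mul_X p j hp => simp [hp, Φ]
  have hsep : Φ.range.SeparatesPoints := by
    intro x y hxy
    obtain ⟨i, hi⟩ : ∃ i, (x : Euc n) i ≠ (y : Euc n) i := by
      by_contra! h
      exact hxy (Subtype.ext (PiLp.ext h))
    exact ⟨Φ (X i), ⟨Φ (X i), ⟨X i, rfl⟩, rfl⟩, by simpa [hΦ] using hi⟩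
  obtain ⟨⟨_, p, rfl⟩, hg⟩ :=
    ContinuousMap.exists_mem_subalgebra_near_continuous_of_separatesPoints _ hsep f
      f.continuous δ hδ
  obtain ⟨q, hq⟩ := exists_harmonic_extension hR p
  refine ⟨_, hq, fun x => ?_⟩
  have h1 := hg x
  have h2 : ‖(x : Euc n)‖ = R := by simp
  have h3 : (((⟨Φ.toRingHom p, p, rfl⟩ : Φ.range) : C(sphere (0 : Euc n) R, ℝ)) x) =
    peval p x := hΦ p x
  rw [h3] at h1
  simpa [h2] using h1

/-- Bounds for a polynomial and its first two derivatives on a closed ball. -/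
structure PolyBound (P : MvPolynomial (Fin n) ℝ) (R M : ℝ) : Prop where
  zero : ∀ x ∈ closedBall (0 : Euc n) R, |peval P x| ≤ M
  one : ∀ x ∈ closedBall (0 : Euc n) R, ∀ i, |peval (pderiv i P) x| ≤ M
  two : ∀ x ∈ closedBall (0 : Euc n) R, ∀ i j, |peval (pderiv i (pderiv j P)) x| ≤ M

theorem PolyBound.mono {P : MvPolynomial (Fin n) ℝ} {R M M' : ℝ} (h : PolyBound P R M)
    (hM : M ≤ M') : PolyBound P R M' :=
  ⟨fun x hx => (h.zero x hx).trans hM, fun x hx i => (h.one x hx i).trans hM,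
    fun x hx i j => (h.two x hx i j).trans hM⟩

theorem exists_polyBound (P : MvPolynomial (Fin n) ℝ) (R : ℝ) : ∃ M, 0 < M ∧ PolyBound P R M := by
  have hb : ∀ Q : MvPolynomial (Fin n) ℝ, ∃ M, 0 ≤ M ∧
      ∀ x ∈ closedBall (0 : Euc n) R, |peval Q x| ≤ M := by
    intro Q
    obtain ⟨M, hM⟩ := (isCompact_closedBall (0 : Euc n) R).exists_bound_of_continuousOn
      (continuous_peval Q).continuousOn
    exact ⟨max M 0, le_max_right _ _, fun x hx => (hM x hx).trans (le_max_left _ _)⟩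
  choose M hM0 hM using hb
  refine ⟨M P + ∑ i, M (pderiv i P) + ∑ i, ∑ j, M (pderiv i (pderiv j P)) + 1, ?_, ?_, ?_, ?_⟩
  · have h1 := Finset.sum_nonneg fun i (_ : i ∈ Finset.univ) => hM0 (pderiv i P)
    have h2 := Finset.sum_nonneg fun i (_ : i ∈ Finset.univ) =>
      Finset.sum_nonneg fun j (_ : j ∈ Finset.univ) => hM0 (pderiv i (pderiv j P))
    linarith [hM0 P]
  all_goals
    intro x hx
    have h1 := fun i => Finset.single_le_sum (fun i (_ : i ∈ Finset.univ) => hM0 (pderiv i P))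
      (Finset.mem_univ i)
    have h2 := fun i => Finset.single_le_sum (fun i (_ : i ∈ Finset.univ) =>
      Finset.sum_nonneg fun j (_ : j ∈ Finset.univ) => hM0 (pderiv i (pderiv j P)))
      (Finset.mem_univ i)
    have h3 := fun i j => Finset.single_le_sum
      (fun j (_ : j ∈ Finset.univ) => hM0 (pderiv i (pderiv j P))) (Finset.mem_univ j)
    have h4 := Finset.sum_nonneg fun i (_ : i ∈ Finset.univ) => hM0 (pderiv i P)
    have h5 := Finset.sum_nonneg fun i (_ : i ∈ Finset.univ) =>
      Finset.sum_nonneg fun j (_ : j ∈ Finset.univ) => hM0 (pderiv i (pderiv j P))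
  · linarith [hM P x hx]
  · intro i; linarith [hM P x hx, h1 i, hM0 P, hM (pderiv i P) x hx]
  · intro i j; linarith [h2 i, h3 i j, hM0 P, hM (pderiv i (pderiv j P)) x hx]

/-! ### Reflections -/

/-- Reflection in the hyperplane `x i₀ = 0`. -/
def hrefl (i₀ : Fin n) (x : Euc n) : Euc n :=
  WithLp.toLp 2 fun j => if j = i₀ then -x j else x j

@[simp] theorem hrefl_apply (i₀ : Fin n) (x : Euc n) (j : Fin n) :
    hrefl i₀ x j = if j = i₀ then -x j else x j := rfl

@[simp] theorem hrefl_hrefl (i₀ : Fin n) (x : Euc n) : hrefl i₀ (hrefl i₀ x) = x := by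
  ext j; by_cases h : j = i₀ <;> simp [h]

theorem hrefl_sub (i₀ : Fin n) (x y : Euc n) : hrefl i₀ (x - y) = hrefl i₀ x - hrefl i₀ y := by
  ext j; by_cases h : j = i₀ <;> simp [h]; ring

@[simp] theorem norm_hrefl (i₀ : Fin n) (x : Euc n) : ‖hrefl i₀ x‖ = ‖x‖ := by
  rw [EuclideanSpace.norm_eq, EuclideanSpace.norm_eq]
  congr 1
  refine Finset.sum_congr rfl fun j _ => ?_
  by_cases h : j = i₀ <;> simp [h]

theorem hrefl_eq_self {i₀ : Fin n} {x : Euc n} (hx : x i₀ = 0) : hrefl i₀ x = x := by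
  ext j
  by_cases h : j = i₀
  · subst h; simp [hx]
  · simp [h]

/-- Reflection of a polynomial. -/
def reflP (i₀ : Fin n) : MvPolynomial (Fin n) ℝ →ₐ[ℝ] MvPolynomial (Fin n) ℝ :=
  aeval fun j => if j = i₀ then -X j else X j

@[simp] theorem peval_reflP (i₀ : Fin n) (P : MvPolynomial (Fin n) ℝ) (x : Euc n) :
    peval (reflP i₀ P) x = peval P (hrefl i₀ x) := by
  induction P using MvPolynomial.induction_on with
  | C a => simp [reflP]
  | add p q hp hq => simp [hp, hq]
  | mul_X p j hp =>
    rw [map_mul, peval_mul, hp, peval_mul]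
    congr 1
    by_cases h : j = i₀ <;> simp [reflP, h]

theorem pderiv_reflP (i₀ j : Fin n) (P : MvPolynomial (Fin n) ℝ) :
    pderiv j (reflP i₀ P) = (if j = i₀ then (-1 : ℝ) else 1) • reflP i₀ (pderiv j P) := by
  induction P using MvPolynomial.induction_on with
  | C a => simp [reflP]
  | add p q hp hq => simp [hp, hq]
  | mul_X p k hp =>
    rw [map_mul, pderiv_mul, hp, pderiv_mul, map_add, map_mul, map_mul, smul_add]
    have : pderiv j (reflP i₀ (X k)) =
        (if j = i₀ then (-1 : ℝ) else 1) • reflP i₀ (pderiv j (X k)) := by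
      by_cases hk : k = i₀ <;> by_cases hj : j = i₀ <;> by_cases hjk : k = j <;>
        simp_all [reflP, pderiv_X]
    rw [this, smul_mul_assoc, mul_smul_comm]

theorem lapP_reflP (i₀ : Fin n) (P : MvPolynomial (Fin n) ℝ) :
    lapP (reflP i₀ P) = reflP i₀ (lapP P) := by
  rw [lapP_apply, lapP_apply, map_sum]
  refine Finset.sum_congr rfl fun j _ => ?_
  by_cases h : j = i₀ <;> simp [pderiv_reflP, h]

theorem reflP_reflP (i₀ : Fin n) (P : MvPolynomial (Fin n) ℝ) : reflP i₀ (reflP i₀ P) = P := by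
  refine MvPolynomial.funext fun x => ?_
  have := peval_reflP i₀ (reflP i₀ P) (WithLp.toLp 2 x)
  rw [peval_reflP i₀ P, hrefl_hrefl] at this
  exact this

/-- On the hyperplane `x i₀ = 0` the normal derivative of an even polynomial vanishes. -/
theorem pderiv_eq_zero_of_even {i₀ : Fin n} {P : MvPolynomial (Fin n) ℝ} (hP : reflP i₀ P = P)
    {x : Euc n} (hx : x i₀ = 0) : peval (pderiv i₀ P) x = 0 := by
  have h := congrArg (fun Q => peval Q x) (pderiv_reflP i₀ i₀ P)
  simp only [hP, if_true, peval_smul, peval_reflP, hrefl_eq_self hx] at h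
  linarith

theorem peval_eq_zero_of_odd {i₀ : Fin n} {P : MvPolynomial (Fin n) ℝ} (hP : reflP i₀ P = -P)
    {x : Euc n} (hx : x i₀ = 0) : peval P x = 0 := by
  have h := congrArg (fun Q => peval Q x) hP
  simp only [peval_reflP, hrefl_eq_self hx, peval_neg] at h
  linarith

theorem pderiv_eq_zero_of_odd {i₀ : Fin n} {P : MvPolynomial (Fin n) ℝ} (hP : reflP i₀ P = -P)
    {j : Fin n} (hj : j ≠ i₀) {x : Euc n} (hx : x i₀ = 0) : peval (pderiv j P) x = 0 := by
  have h := congrArg (fun Q => peval Q x) (pderiv_reflP i₀ j P)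
  simp only [hP, if_neg hj, one_smul, peval_reflP, hrefl_eq_self hx, map_neg, peval_neg] at h
  linarith

/-! ### Uniform approximation of equi-Lipschitz data by harmonic polynomials -/

/-- What matters is that `M` does not depend on `g`. The admissible data form a relatively compact
set, so a finite net suffices; each net element gets one harmonic polynomial, and `M` dominates the
bounds of these finitely many polynomials. -/
theorem harmonic_net [NeZero n] (i₀ : Fin n) {R : ℝ} (hR : 0 < R) (L : ℝ) {δ : ℝ} (hδ : 0 < δ)
    {s : ℝ} (hs : s = 1 ∨ s = -1) :
    ∃ M : ℝ, 0 < M ∧ ∀ g : Euc n → ℝ, (∀ x ∈ sphere (0 : Euc n) R, |g x| ≤ 1) →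
      (∀ x ∈ sphere (0 : Euc n) R, ∀ y ∈ sphere (0 : Euc n) R, |g x - g y| ≤ L * ‖x - y‖) →
      (∀ x ∈ sphere (0 : Euc n) R, g (hrefl i₀ x) = s * g x) →
      ∃ P : MvPolynomial (Fin n) ℝ, lapP P = 0 ∧ reflP i₀ P = s • P ∧
        (∀ x ∈ sphere (0 : Euc n) R, |peval P x - g x| ≤ δ) ∧ PolyBound P R M := by
  classical
  have hss : s * s = 1 := by rcases hs with rfl | rfl <;> norm_num
  have hsa : |s| = 1 := by rcases hs with rfl | rfl <;> norm_num
  set A : Set (BoundedContinuousFunction (sphere (0 : Euc n) R) ℝ) :=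
    {f | (∀ x, |f x| ≤ 1) ∧ ∀ x y, |f x - f y| ≤ L * dist x y}
  have hA : IsCompact (closure A) := by
    refine BoundedContinuousFunction.arzela_ascoli (Icc (-1) 1) isCompact_Icc A
      (fun f x hf => abs_le.1 (hf.1 x)) ?_
    have hL : 0 ≤ max L 0 := le_max_right _ _
    refine LipschitzWith.uniformEquicontinuous (K := ⟨max L 0, hL⟩) _ (fun f => ?_)
      |>.equicontinuous
    refine LipschitzWith.of_dist_le_mul fun x y => ?_
    rw [Real.dist_eq]
    refine (f.2.2 x y).trans ?_
    exact mul_le_mul_of_nonneg_right (le_max_left _ _) dist_nonneg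
  obtain ⟨t, -, htf, hcov⟩ := hA.finite_cover_balls (half_pos hδ)
  choose P hP0 hP using fun f : BoundedContinuousFunction (sphere (0 : Euc n) R) ℝ =>
    exists_harmonic_near hR f.toContinuousMap (half_pos hδ)
  -- Averaging with the signed reflection imposes the parity; since `g` has the same parity, the
  -- error on the sphere does not grow.
  set Q := fun f => (1 / 2 : ℝ) • (P f + s • reflP i₀ (P f))
  choose M hM0 hM using fun f => exists_polyBound (Q f) R
  refine ⟨∑ f ∈ htf.toFinset, M f + 1, ?_, ?_⟩
  · have := Finset.sum_nonneg fun f (_ : f ∈ htf.toFinset) => (hM0 f).le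
    linarith
  intro g hg1 hgL hgs
  have hgc : Continuous fun x : sphere (0 : Euc n) R => g x := by
    have : LipschitzWith ⟨max L 0, le_max_right _ _⟩ fun x : sphere (0 : Euc n) R => g x := by
      refine LipschitzWith.of_dist_le_mul fun x y => ?_
      rw [Real.dist_eq]
      refine (hgL x x.2 y y.2).trans ?_
      rw [Subtype.dist_eq, dist_eq_norm]
      exact mul_le_mul_of_nonneg_right (le_max_left _ _) (norm_nonneg _)
    exact this.continuous
  set G : BoundedContinuousFunction (sphere (0 : Euc n) R) ℝ :=
    BoundedContinuousFunction.mkOfCompact ⟨_, hgc⟩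
  have hGA : G ∈ closure A := subset_closure ⟨fun x => hg1 x x.2, fun x y => by
    rw [Subtype.dist_eq, dist_eq_norm]; exact hgL x x.2 y y.2⟩
  obtain ⟨f, hft, hfG⟩ := mem_iUnion₂.1 (hcov hGA)
  have hPg : ∀ x ∈ sphere (0 : Euc n) R, |peval (P f) x - g x| ≤ δ := by
    intro x hx
    have h1 := hP f ⟨x, hx⟩
    have h2 : |g x - f ⟨x, hx⟩| < δ / 2 := by
      have := (BoundedContinuousFunction.dist_coe_le_dist (f := G) (g := f) ⟨x, hx⟩).trans_lt hfG
      rwa [Real.dist_eq] at this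
    have h3 : |peval (P f) x - f ⟨x, hx⟩| < δ / 2 := h1
    rw [abs_lt] at h2 h3
    exact abs_le.2 ⟨by linarith, by linarith⟩
  refine ⟨Q f, ?_, ?_, ?_, (hM f).mono ?_⟩
  · simp [Q, lapP_reflP, hP0]
  · simp only [Q, map_smul, map_add, reflP_reflP, smul_add, smul_smul]
    rw [show s * (1 / 2 * s) = 1 / 2 by linear_combination (1 / 2) * hss, add_comm,
      mul_comm s (1 / 2)]
  · intro x hx
    have hx' : hrefl i₀ x ∈ sphere (0 : Euc n) R := by simpa using hx
    have h1 := hPg x hx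
    have h2 := hPg _ hx'
    rw [hgs x hx] at h2
    have h3 : peval (Q f) x - g x = (1 / 2) * ((peval (P f) x - g x) +
        s * (peval (P f) (hrefl i₀ x) - s * g x)) := by
      simp [Q]
      linear_combination (1 / 2) * (g x) * hss
    rw [h3, abs_mul]
    have h4 := abs_add_le (peval (P f) x - g x) (s * (peval (P f) (hrefl i₀ x) - s * g x))
    rw [abs_mul s, hsa] at h4
    rw [abs_of_pos (by norm_num : (0 : ℝ) < 1 / 2)]
    linarith
  · have := Finset.single_le_sum (fun f _ => (hM0 f).le) (htf.mem_toFinset.2 hft)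
    linarith

end

noncomputable section
open MvPolynomial
variable {n : ℕ}

/-! ### Derivative estimates for harmonic polynomials -/

theorem pderiv_pderiv_comm (i j : Fin n) (P : MvPolynomial (Fin n) ℝ) :
    pderiv i (pderiv j P) = pderiv j (pderiv i P) := by
  have h : ⁅pderiv (R := ℝ) i, pderiv j⁆ = 0 :=
    derivation_ext fun k => by
      rw [Derivation.commutator_apply]
      by_cases h1 : k = i <;> by_cases h2 : k = j <;> simp [pderiv_X, Pi.single_apply, h1, h2] <;>
        split_ifs <;> simp
  have := congrArg (fun D : Derivation ℝ _ _ => D P) h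
  simpa [Derivation.commutator_apply, sub_eq_zero] using this

theorem lapP_pderiv (i : Fin n) (P : MvPolynomial (Fin n) ℝ) :
    lapP (pderiv i P) = pderiv i (lapP P) := by
  rw [lapP_apply, lapP_apply, map_sum]
  exact Finset.sum_congr rfl fun j _ => by
    rw [pderiv_pderiv_comm j i P, pderiv_pderiv_comm j i]

theorem lapP_X_mul (i : Fin n) (P : MvPolynomial (Fin n) ℝ) :
    lapP (X i * P) = (2 : ℝ) • pderiv i P + X i * lapP P := by
  have h : ∀ j, pderiv j (pderiv j (X i * P)) =
      (if j = i then (2 : ℝ) • pderiv i P else 0) + X i * pderiv j (pderiv j P) := fun j => by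
    by_cases hj : j = i
    · subst hj
      simp only [pderiv_mul, pderiv_X_self, map_add, pderiv_one, if_true, two_smul]
      ring
    · simp [pderiv_X_of_ne (Ne.symm hj), hj]
  simp only [lapP_apply, h, Finset.sum_add_distrib, Finset.mul_sum]
  simp

theorem harmonicOnNhd_peval {P : MvPolynomial (Fin n) ℝ} (hP : lapP P = 0) (s : Set (Euc n)) :
    HarmonicOnNhd (peval P) s := fun x _ =>
  ⟨contDiffAt_peval P x, Eventually.of_forall fun y => by rw [laplacian_peval, hP]; simp⟩

/-- Interior gradient estimate. -/
theorem abs_pderiv_le [NeZero n] {P : MvPolynomial (Fin n) ℝ} (hP : lapP P = 0) {x : Euc n}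
    {ρ A : ℝ} (hρ : 0 < ρ) (hA : ∀ y ∈ closedBall x ρ, |peval P y| ≤ A) (i : Fin n) :
    |peval (pderiv i P) x| ≤ n * A / ρ := by
  have hA0 : 0 ≤ A := (abs_nonneg _).trans (hA x (mem_closedBall_self hρ.le))
  set e : Euc n := EuclideanSpace.single i 1
  have he : ‖e‖ = 1 := by simp [e]
  -- A symmetric difference keeps the midpoint at `x`, so the Lipschitz estimate always uses the
  -- same ball.
  set f : ℝ → ℝ := fun t => peval P (x + t • e) - peval P (x - t • e)
  have hf : HasDerivAt f (2 * peval (pderiv i P) x) 0 := by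
    have h1 : HasDerivAt (fun t : ℝ => x + t • e) e 0 := by
      simpa using ((hasDerivAt_id (0 : ℝ)).smul_const e).const_add x
    have h2 : HasDerivAt (fun t : ℝ => x - t • e) (-e) 0 := by
      simpa using ((hasDerivAt_id (0 : ℝ)).smul_const e).const_sub x
    have h3 := (hasFDerivAt_peval P (x + (0 : ℝ) • e)).comp_hasDerivAt 0 h1
    have h4 := (hasFDerivAt_peval P (x - (0 : ℝ) • e)).comp_hasDerivAt 0 h2
    refine (h3.sub h4).congr_deriv ?_
    simp [e, sum_apply]
    ring
  have hb : ‖2 * peval (pderiv i P) x‖ ≤ 2 * (n * A / ρ) := by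
    refine hf.le_of_lip' (by positivity) ?_
    filter_upwards [ball_mem_nhds (0 : ℝ) hρ] with t ht
    have ht : |t| < ρ := by simpa using ht
    have hmid : midpoint ℝ (x + t • e) (x - t • e) = x := by
      rw [midpoint_eq_smul_add, invOf_eq_inv]; module
    have hd : ‖x + t • e - (x - t • e)‖ = 2 * |t| := by
      rw [show x + t • e - (x - t • e) = (2 * t) • e by module, norm_smul, he, mul_one,
        Real.norm_eq_abs, abs_mul, abs_two]
    have := harmonic_lipschitz (x := x + t • e) (y := x - t • e) hρ (harmonicOnNhd_peval hP _)
      (by rwa [hmid]) (by rw [hd]; linarith)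
    rw [hd] at this
    have h0 : f 0 = 0 := by simp [f]
    rw [h0, sub_zero, sub_zero, Real.norm_eq_abs, Real.norm_eq_abs]
    refine this.trans (le_of_eq ?_)
    ring
  rw [Real.norm_eq_abs, abs_mul, abs_two] at hb
  linarith

theorem closedBall_subset_of_norm_le {x : Euc n} {a b c : ℝ} (hx : ‖x‖ ≤ a) (h : a + b ≤ c) :
    closedBall x b ⊆ closedBall 0 c :=
  closedBall_subset_closedBall' (by rw [dist_zero_right]; linarith)

theorem abs_coord_le (x : Euc n) (i : Fin n) : |x i| ≤ ‖x‖ := PiLp.norm_apply_le x i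

/-- First order Taylor expansion of harmonic polynomials with a quantified error. -/
theorem harmonic_taylor [NeZero n] {P : MvPolynomial (Fin n) ℝ} (hP : lapP P = 0)
    {R A : ℝ} (hR : 0 < R) (hA : ∀ y ∈ closedBall (0 : Euc n) R, |peval P y| ≤ A)
    {x : Euc n} (hx : ‖x‖ ≤ R / 4) :
    |peval P x - peval P 0 - ∑ i, peval (pderiv i P) 0 * x i| ≤
      8 * n ^ 3 * A / R ^ 2 * ‖x‖ ^ 2 := by
  have hA0 : 0 ≤ A := (abs_nonneg _).trans (hA 0 (mem_closedBall_self hR.le))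
  -- The first derivatives are harmonic too, so the Lipschitz estimate applied to them, with this
  -- bound, controls the oscillation of the gradient; the mean value inequality then gives the
  -- quadratic error.
  have h1 : ∀ i, ∀ y ∈ closedBall (0 : Euc n) (R / 2), |peval (pderiv i P) y| ≤ 2 * n * A / R := by
    intro i y hy
    have := abs_pderiv_le hP (x := y) (half_pos hR) (A := A) (fun z hz =>
      hA z (closedBall_subset_of_norm_le (by simpa using hy) (by linarith) hz)) i
    refine this.trans (le_of_eq ?_)
    field_simp
  have h2 : ∀ i, ∀ y ∈ closedBall (0 : Euc n) ‖x‖,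
      |peval (pderiv i P) y - peval (pderiv i P) 0| ≤ 8 * n ^ 2 * A / R ^ 2 * ‖x‖ := by
    intro i y hy
    have hy : ‖y‖ ≤ ‖x‖ := by simpa using hy
    have hmid : ‖midpoint ℝ y 0‖ ≤ R / 4 := by
      rw [midpoint_eq_smul_add, invOf_eq_inv, add_zero, norm_smul]
      norm_num
      linarith [norm_nonneg y]
    have := harmonic_lipschitz (u := peval (pderiv i P)) (x := y) (y := 0) (ρ := R / 4)
      (A := 2 * n * A / R) (by positivity)
      (harmonicOnNhd_peval (by rw [lapP_pderiv, hP, map_zero]) _)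
      (fun z hz => h1 i z (closedBall_subset_of_norm_le hmid (by linarith) hz))
      (by rw [sub_zero]; linarith [norm_nonneg y])
    refine this.trans ?_
    rw [sub_zero, show (n : ℝ) * (2 * n * A / R) / (R / 4) = 8 * n ^ 2 * A / R ^ 2 by
      field_simp; ring]
    exact mul_le_mul_of_nonneg_left hy (by positivity)
  have h3 := (convex_closedBall (0 : Euc n) ‖x‖).norm_image_sub_le_of_norm_hasFDerivWithin_le'
    (f := peval P) (C := 8 * n ^ 3 * A / R ^ 2 * ‖x‖)
    (φ := ∑ i, peval (pderiv i P) 0 • (EuclideanSpace.proj i : Euc n →L[ℝ] ℝ))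
    (fun y _ => (hasFDerivAt_peval P y).hasFDerivWithinAt) (fun y hy => by
      rw [← Finset.sum_sub_distrib]
      refine (norm_sum_le _ _).trans ?_
      have : ∀ i ∈ Finset.univ, ‖peval (pderiv i P) y • (EuclideanSpace.proj i : Euc n →L[ℝ] ℝ) -
          peval (pderiv i P) 0 • (EuclideanSpace.proj i : Euc n →L[ℝ] ℝ)‖ ≤
          8 * n ^ 2 * A / R ^ 2 * ‖x‖ := fun i _ => by
        rw [← sub_smul]
        refine ContinuousLinearMap.opNorm_le_bound _ (by positivity) fun z => ?_
        rw [smul_apply, norm_smul, Real.norm_eq_abs]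
        exact mul_le_mul (h2 i y hy) (abs_coord_le z i) (norm_nonneg _) (by positivity)
      refine (Finset.sum_le_card_nsmul _ _ _ this).trans (le_of_eq ?_)
      rw [Finset.card_univ, Fintype.card_fin, nsmul_eq_mul]
      ring)
    (x := 0) (y := x) (by simp) (by simp)
  simp only [sub_zero, sum_apply, smul_apply, PiLp.proj_apply, smul_eq_mul,
    Real.norm_eq_abs] at h3
  refine h3.trans (le_of_eq ?_)
  ring

/-! ### Harmonic polynomials that are large near the equator and small inside -/

/-- Polynomials that are increasing and bounded on `[-1, 1]` with a steep slope at the origin. -/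
theorem exists_steep_polynomial (k : ℕ) : ∃ f : Polynomial ℝ,
    (∀ z ∈ Icc (-1 : ℝ) 1, |f.eval z| ≤ 1) ∧ (∀ z ∈ Icc (-1 : ℝ) 1, 0 ≤ f.derivative.eval z) ∧
      f.eval 0 = 0 ∧ f.derivative.eval 0 = (3 / 2) ^ k := by
  induction k with
  | zero => exact ⟨Polynomial.X, fun z hz => by simpa using abs_le.2 hz, by simp, by simp, by simp⟩
  -- Compose with y ↦ (3y - y³)/2, which fixes 0, maps [-1, 1] into itself, is nondecreasing there
  -- and has slope 3/2 at 0.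
  | succ k ih =>
    obtain ⟨f, h1, h2, h3, h4⟩ := ih
    have hd : ∀ z, (Polynomial.C (1 / 2) * (3 * f - f ^ 3)).derivative.eval z =
        3 / 2 * (1 - f.eval z ^ 2) * f.derivative.eval z := fun z => by
      simp [Polynomial.derivative_pow]; ring
    refine ⟨Polynomial.C (1 / 2) * (3 * f - f ^ 3), fun z hz => ?_, fun z hz => ?_, ?_, ?_⟩
    · have := abs_le.1 (h1 z hz)
      simp only [Polynomial.eval_mul, Polynomial.eval_C, Polynomial.eval_sub,
        Polynomial.eval_ofNat, Polynomial.eval_pow]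
      generalize f.eval z = y at *
      rw [abs_le]
      constructor <;> nlinarith [sq_nonneg (y - 1), sq_nonneg (y + 1)]
    · have := abs_le.1 (h1 z hz)
      rw [hd]
      have h5 : 0 ≤ 1 - f.eval z ^ 2 := by nlinarith
      exact mul_nonneg (by linarith) (h2 z hz)
    · simp [h3]
    · rw [hd, h3, h4]; ring

/-- Boundary data concentrated near the equator have a small harmonic extension inside if they are
tangential derivatives of small functions. Rotation fields commute with the Laplacian and see only
boundary values, so the extension is obtained by rotating harmonic functions of size `R * s`, and
the interior gradient estimate bounds the result. A steep but bounded profile `f` makes the data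
large at the equator. In dimension one the sum defining `b` is empty, and so is the equatorial
region, because `δ < R`. -/
theorem exists_equatorial_barrier [NeZero n] (i₀ : Fin n) {R : ℝ} (hR : 0 < R) {σ : ℝ}
    (hσ : 0 < σ) : ∃ b : MvPolynomial (Fin n) ℝ, ∃ δ : ℝ, 0 < δ ∧ lapP b = 0 ∧ reflP i₀ b = b ∧
      (∀ x ∈ closedBall (0 : Euc n) R, 0 ≤ peval b x) ∧
      (∀ x ∈ sphere (0 : Euc n) R, |x i₀| ≤ δ → 4 ≤ peval b x) ∧
      (∀ x ∈ closedBall (0 : Euc n) (R / 2), |peval b x| ≤ σ) := by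
  have hn : (0 : ℝ) < n := by exact_mod_cast Nat.pos_of_ne_zero (NeZero.ne n)
  set s : ℝ := σ / (R * n * (1 + 2 * n))
  have hs : 0 < s := by positivity
  -- The boundary value on the equator will be s R (3/2)^k, which has to exceed 4.
  obtain ⟨k, hk⟩ := pow_unbounded_of_one_lt (5 / (s * R)) (by norm_num : (1 : ℝ) < 3 / 2)
  obtain ⟨f, hf1, hf2, -, hf4⟩ := exists_steep_polynomial k
  set Z : MvPolynomial (Fin n) ℝ := X i₀
  set F : MvPolynomial (Fin n) ℝ := s • Polynomial.aeval (R⁻¹ • Z) f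
  set F' : MvPolynomial (Fin n) ℝ := (s / R) • Polynomial.aeval (R⁻¹ • Z) f.derivative
  have haev : ∀ (g : Polynomial ℝ) (x : Euc n),
      peval (Polynomial.aeval (R⁻¹ • Z) g) x = g.eval (R⁻¹ * x i₀) := fun g x => by
    have := Polynomial.aeval_algHom_apply (MvPolynomial.aeval (R := ℝ) fun i => x i) (R⁻¹ • Z) g
    have h2 : ∀ P : MvPolynomial (Fin n) ℝ,
      MvPolynomial.aeval (R := ℝ) (fun i => x i) P = peval P x := fun P => by
        rw [MvPolynomial.aeval_eq_eval]; rfl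
    rw [h2, h2] at this
    rw [← this]
    simp [Z]
  have hdF : ∀ j, pderiv j F = if j = i₀ then F' else 0 := fun j => by
    simp only [F, F', Derivation.map_smul, Derivation.map_aeval, Z]
    by_cases h : j = i₀
    · subst h
      simp only [pderiv_X_self, if_true, smul_eq_mul, mul_smul_comm, mul_one, smul_smul]
      rfl
    · simp [h, pderiv_X_of_ne (Ne.symm h)]
  have hz : ∀ x ∈ closedBall (0 : Euc n) R, R⁻¹ * x i₀ ∈ Icc (-1 : ℝ) 1 := fun x hx => by
    have h1 : |x i₀| ≤ R := (abs_coord_le x i₀).trans (by simpa using hx)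
    rw [mem_Icc, ← abs_le, abs_mul, abs_of_pos (inv_pos.2 hR), inv_mul_le_iff₀ hR]
    linarith
  have hFb : ∀ x ∈ closedBall (0 : Euc n) R, |peval F x| ≤ s := fun x hx => by
    rw [peval_smul, haev, abs_mul, abs_of_pos hs]
    exact mul_le_of_le_one_right hs.le (hf1 _ (hz x hx))
  obtain ⟨q₀, hq₀⟩ := exists_harmonic_extension hR (Z * F)
  choose q hq using fun j : Fin n => exists_harmonic_extension hR (X j * F)
  set Q : MvPolynomial (Fin n) ℝ := sqNormP n - C (R ^ 2)
  set H₀ := Z * F - Q * q₀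
  set H : Fin n → MvPolynomial (Fin n) ℝ := fun j => X j * F - Q * q j
  have hH : ∀ j, lapP (H j) = 0 := hq
  have hQs : ∀ x ∈ sphere (0 : Euc n) R, peval Q x = 0 := fun x hx => by
    have : ‖x‖ = R := by simpa using hx
    simp [Q, this]
  have hdQ : ∀ j, pderiv j Q = 2 * X j := fun j => by simp [Q, pderiv_sqNormP]
  have hxF : ∀ j, ∀ x ∈ sphere (0 : Euc n) R, |x j * peval F x| ≤ R * s := fun j x hx => by
    have h1 : |x j| ≤ R := (abs_coord_le x j).trans (by simpa using (mem_sphere.1 hx).le)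
    rw [abs_mul]
    exact mul_le_mul h1 (hFb x (sphere_subset_closedBall hx)) (abs_nonneg _) hR.le
  have hH₀b : ∀ x ∈ closedBall (0 : Euc n) R, |peval H₀ x| ≤ R * s :=
    abs_peval_le_of_sphere hq₀ fun x hx => by
      simpa [H₀, hQs x hx, Z] using hxF i₀ x hx
  have hHb : ∀ j, ∀ x ∈ closedBall (0 : Euc n) R, |peval (H j) x| ≤ R * s := fun j =>
    abs_peval_le_of_sphere (hH j) fun x hx => by
      simpa [H, hQs x hx] using hxF j x hx
  have hdH : ∀ j i, ∀ x ∈ closedBall (0 : Euc n) (R / 2),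
      |peval (pderiv i (H j)) x| ≤ 2 * n * s := by
    intro j i x hx
    refine (abs_pderiv_le (hH j) (x := x) (half_pos hR) (A := R * s) (fun z hz => hHb j z
      (closedBall_subset_of_norm_le (by simpa using hx) (by linarith) hz)) i).trans (le_of_eq ?_)
    field_simp
  -- On the sphere `H j` equals x_j F, and the tangential field z∂_j - x_j∂_z maps it to zF -
  -- x_j²F'. Subtracting this from `H₀` leaves x_j²F', and the sum over j is (R² - z²)F' ≥ 0.
  set b : MvPolynomial (Fin n) ℝ := ∑ j ∈ Finset.univ.erase i₀,
    (H₀ - (Z * pderiv j (H j) - X j * pderiv i₀ (H j)))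
  have hb0 : lapP b = 0 := by
    simp only [b, map_sum]
    refine Finset.sum_eq_zero fun j _ => ?_
    rw [map_sub lapP H₀, hq₀, map_sub]
    simp only [Z, lapP_X_mul, lapP_pderiv, hH, map_zero, mul_zero, pderiv_pderiv_comm i₀ j]
    simp
  have hbs : ∀ x ∈ sphere (0 : Euc n) R, peval b x = (R ^ 2 - x i₀ ^ 2) * peval F' x := by
    intro x hx
    have hx1 : R ^ 2 - x i₀ ^ 2 = ∑ j ∈ Finset.univ.erase i₀, x j ^ 2 := by
      have : ‖x‖ = R := by simpa using hx
      rw [← this, EuclideanSpace.real_norm_sq_eq, Finset.sum_erase_eq_sub (Finset.mem_univ _)]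
    rw [hx1, Finset.sum_mul]
    simp only [b, peval_sum]
    refine Finset.sum_congr rfl fun j hj => ?_
    have hj : j ≠ i₀ := Finset.ne_of_mem_erase hj
    simp only [H₀, H, peval_sub, peval_mul, map_sub, pderiv_mul, peval_add, hdF, hdQ, hQs x hx,
      Z, peval_X, pderiv_X_self, pderiv_X_of_ne hj, if_neg hj, if_true, peval_one, peval_zero]
    ring
  have hbp : ∀ x ∈ closedBall (0 : Euc n) R, 0 ≤ peval b x := by
    intro x hx
    have := peval_le_of_sphere (P := -b) (R := R) (A := 0) (by simp [hb0]) (fun y hy => by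
      have hy' := sphere_subset_closedBall hy
      have h1 : |y i₀| ≤ R := (abs_coord_le y i₀).trans (by simpa using hy')
      have h2 : 0 ≤ R ^ 2 - y i₀ ^ 2 := by
        have := sq_abs (y i₀)
        nlinarith [abs_nonneg (y i₀)]
      have h3 : 0 ≤ peval F' y := by
        simp only [F', peval_smul, haev]
        exact mul_nonneg (by positivity) (hf2 _ (hz y hy'))
      rw [peval_neg, hbs y hy]
      nlinarith [mul_nonneg h2 h3]) x hx
    simpa using this
  have hbi : ∀ x ∈ closedBall (0 : Euc n) (R / 2), |peval b x| ≤ σ := by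
    intro x hx
    have hx' : ‖x‖ ≤ R / 2 := by simpa using hx
    simp only [b, peval_sum]
    have hxR : x ∈ closedBall (0 : Euc n) R := closedBall_subset_closedBall (by linarith) hx
    have h1 : ∀ j ∈ Finset.univ.erase i₀,
        |peval (H₀ - (Z * pderiv j (H j) - X j * pderiv i₀ (H j))) x| ≤ R * s * (1 + 2 * n) := by
      intro j _
      simp only [peval_sub, peval_mul, Z, peval_X]
      have e0 := hH₀b x hxR
      have e1 : |x i₀ * peval (pderiv j (H j)) x| ≤ R / 2 * (2 * n * s) := by
        rw [abs_mul]
        exact mul_le_mul ((abs_coord_le x i₀).trans hx') (hdH j j x hx) (abs_nonneg _)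
          (by positivity)
      have e2 : |x j * peval (pderiv i₀ (H j)) x| ≤ R / 2 * (2 * n * s) := by
        rw [abs_mul]
        exact mul_le_mul ((abs_coord_le x j).trans hx') (hdH j i₀ x hx) (abs_nonneg _)
          (by positivity)
      rw [abs_le] at e0 e1 e2 ⊢
      constructor <;> nlinarith
    refine (Finset.abs_sum_le_sum_abs _ _).trans ((Finset.sum_le_card_nsmul _ _ _ h1).trans ?_)
    rw [Finset.card_erase_of_mem (Finset.mem_univ _), Finset.card_univ, Fintype.card_fin,
      nsmul_eq_mul]
    have h2 : ((n - 1 : ℕ) : ℝ) ≤ n := by exact_mod_cast Nat.sub_le n 1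
    have h3 : (n : ℝ) * (R * s * (1 + 2 * n)) = σ := by
      simp only [s]; field_simp
    rw [← h3]
    exact mul_le_mul_of_nonneg_right h2 (by positivity)
  obtain ⟨δ, hδ, hδb⟩ : ∃ δ : ℝ, 0 < δ ∧ ∀ z : ℝ, |z| ≤ δ →
      4 ≤ (R ^ 2 - z ^ 2) * (s / R * f.derivative.eval (R⁻¹ * z)) := by
    have hc : Continuous fun z : ℝ => (R ^ 2 - z ^ 2) * (s / R * f.derivative.eval (R⁻¹ * z)) := by
      have := f.derivative.continuous
      fun_prop
    have h0 : (4 : ℝ) < (R ^ 2 - 0 ^ 2) * (s / R * f.derivative.eval (R⁻¹ * 0)) := by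
      rw [mul_zero, hf4]
      rw [div_lt_iff₀ (by positivity)] at hk
      have : (R ^ 2 - 0 ^ 2) * (s / R * (3 / 2) ^ k) = (3 / 2) ^ k * (s * R) := by
        field_simp; ring
      rw [this]; linarith
    have := (hc.tendsto 0).eventually (lt_mem_nhds h0)
    obtain ⟨δ, hδ, h⟩ := Metric.eventually_nhds_iff_ball.1 this
    exact ⟨δ / 2, by positivity, fun z hz => (h z (by
      rw [mem_ball_zero_iff, Real.norm_eq_abs]; linarith)).le⟩
  have hb4 : ∀ x ∈ sphere (0 : Euc n) R, |x i₀| ≤ δ → 4 ≤ peval b x := by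
    intro x hx hxδ
    rw [hbs x hx]
    simpa only [F', peval_smul, haev] using hδb _ hxδ
  refine ⟨(1 / 2 : ℝ) • (b + reflP i₀ b), δ, hδ, ?_, ?_, ?_, ?_, ?_⟩
  · simp [lapP_reflP, hb0]
  · simp [reflP_reflP, add_comm]
  · intro x hx
    have h1 := hbp x hx
    have h2 := hbp (hrefl i₀ x) (by simpa using hx)
    simp only [peval_smul, peval_add, peval_reflP]
    linarith
  · intro x hx hxδ
    have h1 := hb4 x hx hxδ
    have h2 := hb4 (hrefl i₀ x) (by simpa using hx) (by simpa using hxδ)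
    simp only [peval_smul, peval_add, peval_reflP]
    linarith
  · intro x hx
    have h1 := abs_le.1 (hbi x hx)
    have h2 := abs_le.1 (hbi (hrefl i₀ x) (by simpa using hx))
    simp only [peval_smul, peval_add, peval_reflP]
    rw [abs_le]
    constructor <;> linarith

end

noncomputable section
open MvPolynomial
variable {n m : ℕ}

/-! ### Comparison with polynomials for viscosity solutions -/

section comparison
variable {U : Euc n → Euc m} {Ω : Set (Euc n)}

theorem isOpen_positivitySet (hΩ : IsOpen Ω) (hU : ContinuousOn U Ω) :
    IsOpen (positivitySet Ω U) := by
  have := hU.norm.isOpen_inter_preimage hΩ (isOpen_Ioi (a := (0 : ℝ)))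
  convert this using 1
  ext x
  simp [positivitySet]

theorem eq_zero_of_notMem_positivitySet {x : Euc n} (hx : x ∈ Ω)
    (h : x ∉ positivitySet Ω U) : U x = 0 := by
  by_contra h0
  exact h ⟨hx, norm_pos_iff.2 h0⟩

theorem notMem_positivitySet_of_mem_freeBoundary (hΩ : IsOpen Ω) (hU : ContinuousOn U Ω)
    {x : Euc n} (hx : x ∈ freeBoundary Ω U) : x ∉ positivitySet Ω U := fun h =>
  (hx.2).2 ((isOpen_positivitySet hΩ hU).interior_eq.symm ▸ h)

theorem mem_freeBoundary_of_mem_closure {x : Euc n} (hx : x ∈ Ω)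
    (hc : x ∈ closure (positivitySet Ω U)) (h : x ∉ positivitySet Ω U) :
    x ∈ freeBoundary Ω U := ⟨hx, hc, fun h' => h (interior_subset h')⟩

theorem harmonicAt_inner {x : Euc n} (h : ∀ i, HarmonicAt (fun y => U y i) x) (f : Euc m) :
    HarmonicAt (fun y => inner ℝ (U y) f) x := by
  have h1 : (fun y => inner ℝ (U y) f) = fun y => ∑ i, f i * U y i := by
    ext y; simp [PiLp.inner_apply]
  have h2 : ∀ s : Finset (Fin m), HarmonicAt (fun y => ∑ i ∈ s, f i * U y i) x := by
    classical
    intro s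
    induction s using Finset.induction_on with
    | empty => simp
    | insert a s ha ih =>
      simp only [Finset.sum_insert ha]
      exact ((h a).const_smul (c := f a)).add ih
  rw [h1]
  exact h2 _

theorem norm_gradient_peval_sub_C (φ : MvPolynomial (Fin n) ℝ) (t : ℝ) (x : Euc n) :
    ‖∇ (peval (φ - C t)) x‖ = ‖∇ (peval φ) x‖ := by
  have h : ‖∇ (peval (φ - C t)) x‖ ^ 2 = ‖∇ (peval φ) x‖ ^ 2 := by
    simp [norm_gradient_peval_sq]
  exact (sq_eq_sq₀ (norm_nonneg _) (norm_nonneg _)).1 h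

/-- The lower comparison principle for the components of a viscosity solution. -/
theorem peval_le_of_viscosity (hU : IsViscositySolution (ball 0 1) U) {R : ℝ} (hR : R < 1)
    {f : Euc m} (hf : ‖f‖ = 1) {φ : MvPolynomial (Fin n) ℝ}
    (hlap : ∀ x ∈ ball (0 : Euc n) R, 0 < peval (lapP φ) x)
    (hgrad : ∀ x ∈ freeBoundary (ball 0 1) U, x ∈ ball (0 : Euc n) R → 1 < ‖∇ (peval φ) x‖)
    (hs : ∀ x ∈ sphere (0 : Euc n) R, peval φ x ≤ inner ℝ (U x) f) :
    ∀ x ∈ closedBall (0 : Euc n) R, peval φ x ≤ inner ℝ (U x) f := by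
  intro x₀ hx₀
  have hsub : closedBall (0 : Euc n) R ⊆ ball 0 1 := closedBall_subset_ball hR
  have hΩ : IsOpen (ball (0 : Euc n) 1) := isOpen_ball
  set D : Euc n → ℝ := peval φ - fun x => inner ℝ (U x) f
  have hD : ContinuousOn D (closedBall 0 R) := (continuous_peval φ).continuousOn.sub
    ((hU.continuousOn.mono hsub).inner continuousOn_const)
  obtain ⟨x₁, hx₁, hmax⟩ := (isCompact_closedBall (0 : Euc n) R).exists_isMaxOn ⟨x₀, hx₀⟩ hD
  suffices h : D x₁ ≤ 0 by
    have h1 : D x₀ ≤ D x₁ := hmax hx₀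
    have h2 : D x₀ = peval φ x₀ - inner ℝ (U x₀) f := rfl
    linarith
  by_contra! hpos
  have hx₁b : x₁ ∈ ball (0 : Euc n) R := by
    refine (mem_closedBall.1 hx₁).lt_of_ne fun h => ?_
    have h1 := hs x₁ h
    have h2 : D x₁ = peval φ x₁ - inner ℝ (U x₁) f := rfl
    linarith
  have hloc : IsLocalMax D x₁ := hmax.isLocalMax (closedBall_mem_nhds_of_mem hx₁b)
  have hl := hlap x₁ hx₁b
  -- An interior maximum with positive excess is excluded in three cases: in Ω(U) by strict
  -- subharmonicity; on F(U) because φ lowered by the excess touches from below with slope above 1;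
  -- inside the zero set because φ itself would have a local maximum.
  by_cases hP : x₁ ∈ positivitySet (ball 0 1) U
  · have hh := harmonicAt_inner (fun i => hU.harmonic i x₁ hP) f
    have h1 := laplacian_nonpos_of_isLocalMax ((contDiffAt_peval φ x₁).sub hh.1) hloc
    have h2 : Laplacian.laplacian D x₁ = _ := (contDiffAt_peval φ x₁).laplacian_sub hh.1
    have h3 : Laplacian.laplacian (fun y => inner ℝ (U y) f) x₁ = 0 := hh.2.self_of_nhds
    rw [laplacian_peval, h3] at h2
    have h1 : Laplacian.laplacian D x₁ ≤ 0 := h1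
    linarith
  · have hU0 := eq_zero_of_notMem_positivitySet (hsub hx₁) hP
    by_cases hc : x₁ ∈ closure (positivitySet (ball 0 1) U)
    · have hfb := mem_freeBoundary_of_mem_closure (hsub hx₁) hc hP
      refine hU.not_touched_below x₁ hfb (peval (φ - C (D x₁))) (contDiffAt_peval _ _) ?_ f hf
        ⟨?_, ?_⟩
      · rw [norm_gradient_peval_sub_C]; exact hgrad x₁ hfb hx₁b
      · simp [D]
      · filter_upwards [hloc] with y hy
        have h2 : D y = peval φ y - inner ℝ (U y) f := rfl
        simp only [peval_sub, peval_C]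
        linarith
    · have hnear : ∀ᶠ y in 𝓝 x₁, U y = 0 := by
        filter_upwards [isClosed_closure.isOpen_compl.mem_nhds hc,
          hΩ.mem_nhds (hsub hx₁)] with y hy hy1
        exact eq_zero_of_notMem_positivitySet hy1 fun h => hy (subset_closure h)
      have hloc' : IsLocalMax (peval φ) x₁ := by
        filter_upwards [hloc, hnear] with y hy hy0
        simpa [D, hy0, hU0] using hy
      have := laplacian_nonpos_of_isLocalMax (contDiffAt_peval φ x₁) hloc'
      rw [laplacian_peval] at this
      linarith

/-- The upper comparison principle for the norm of a viscosity solution. -/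
theorem norm_le_of_viscosity (hU : IsViscositySolution (ball 0 1) U) {R : ℝ} (hR : R < 1)
    {φ : MvPolynomial (Fin n) ℝ} (hlap : ∀ x ∈ ball (0 : Euc n) R, peval (lapP φ) x < 0)
    (hgrad : ∀ x ∈ freeBoundary (ball 0 1) U, x ∈ ball (0 : Euc n) R →
      0 < ‖∇ (peval φ) x‖ ∧ ‖∇ (peval φ) x‖ < 1)
    (hs : ∀ x ∈ sphere (0 : Euc n) R, x ∈ closure (positivitySet (ball 0 1) U) →
      ‖U x‖ ≤ peval φ x) :
    ∀ x ∈ closedBall (0 : Euc n) R, x ∈ closure (positivitySet (ball 0 1) U) →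
      ‖U x‖ ≤ peval φ x := by
  intro x₀ hx₀ hx₀c
  have hsub : closedBall (0 : Euc n) R ⊆ ball 0 1 := closedBall_subset_ball hR
  have hΩ : IsOpen (ball (0 : Euc n) 1) := isOpen_ball
  set K := closedBall (0 : Euc n) R ∩ closure (positivitySet (ball 0 1) U)
  have hK : IsCompact K := (isCompact_closedBall _ _).inter_right isClosed_closure
  set D : Euc n → ℝ := fun x => ‖U x‖ - peval φ x
  have hD : ContinuousOn D K := (hU.continuousOn.mono (inter_subset_left.trans hsub)).norm.sub
    (continuous_peval φ).continuousOn
  obtain ⟨x₁, ⟨hx₁, hx₁c⟩, hmax⟩ := hK.exists_isMaxOn ⟨x₀, hx₀, hx₀c⟩ hD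
  suffices h : D x₁ ≤ 0 by
    have h1 : D x₀ ≤ D x₁ := hmax ⟨hx₀, hx₀c⟩
    have h2 : D x₀ = ‖U x₀‖ - peval φ x₀ := rfl
    linarith
  by_contra! hpos
  have hD₁ : D x₁ = ‖U x₁‖ - peval φ x₁ := rfl
  have hx₁b : x₁ ∈ ball (0 : Euc n) R := by
    refine (mem_closedBall.1 hx₁).lt_of_ne fun h => ?_
    have h1 := hs x₁ h hx₁c
    linarith
  have hnb := closedBall_mem_nhds_of_mem hx₁b
  by_cases hP : x₁ ∈ positivitySet (ball 0 1) U
  -- In the direction of U(x₁), the harmonic function ⟨U, f⟩ lies below |U| with equality at x₁, so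
  -- the second derivative test applies to it instead of |U|.
  · set f : Euc m := ‖U x₁‖⁻¹ • U x₁
    have hne : ‖U x₁‖ ≠ 0 := hP.2.ne'
    have hf : ‖f‖ = 1 := by simp [f, norm_smul, hne]
    have hf1 : inner ℝ (U x₁) f = ‖U x₁‖ := by
      simp only [f, real_inner_smul_right, real_inner_self_eq_norm_sq]
      field_simp
    have hh := harmonicAt_inner (fun i => hU.harmonic i x₁ hP) f
    have hloc : IsLocalMax ((fun y => inner ℝ (U y) f) - peval φ) x₁ := by
      filter_upwards [hnb, (isOpen_positivitySet hΩ hU.continuousOn).mem_nhds hP] with y hy hy1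
      have h1 : D y ≤ D x₁ := hmax ⟨hy, subset_closure hy1⟩
      have h2 : D y = ‖U y‖ - peval φ y := rfl
      have h3 : inner ℝ (U y) f ≤ ‖U y‖ := by simpa [hf] using real_inner_le_norm (U y) f
      simp only [Pi.sub_apply, hf1]
      linarith
    have h1 := laplacian_nonpos_of_isLocalMax (hh.1.sub (contDiffAt_peval φ x₁)) hloc
    have h2 : Laplacian.laplacian ((fun y => inner ℝ (U y) f) - peval φ) x₁ = _ :=
      hh.1.laplacian_sub (contDiffAt_peval φ x₁)
    have h3 : Laplacian.laplacian (fun y => inner ℝ (U y) f) x₁ = 0 := hh.2.self_of_nhds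
    rw [laplacian_peval, h3] at h2
    have h1 : Laplacian.laplacian ((fun y => inner ℝ (U y) f) - peval φ) x₁ ≤ 0 := h1
    linarith [hlap x₁ hx₁b]
  · have hU0 := eq_zero_of_notMem_positivitySet (hsub hx₁) hP
    have hfb := mem_freeBoundary_of_mem_closure (hsub hx₁) hx₁c hP
    have hDφ : D x₁ = -peval φ x₁ := by rw [hD₁, hU0]; simp
    have hg := hgrad x₁ hfb hx₁b
    rw [← norm_gradient_peval_sub_C φ (peval φ x₁)] at hg
    -- The shifted polynomial dominates |U| only on the closure of Ω(U); elsewhere U = 0 and the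
    -- positive part suffices.
    refine hU.not_touched_above x₁ hfb (peval (φ - C (peval φ x₁))) (contDiffAt_peval _ _)
      (norm_pos_iff.1 hg.1) hg.2 ⟨by simp [hU0], ?_⟩
    filter_upwards [hnb] with y hy
    by_cases hyc : y ∈ closure (positivitySet (ball 0 1) U)
    · refine le_max_of_le_left ?_
      have h1 : D y ≤ D x₁ := hmax ⟨hy, hyc⟩
      have h2 : D y = ‖U y‖ - peval φ y := rfl
      simp only [peval_sub, peval_C]
      linarith
    · rw [eq_zero_of_notMem_positivitySet (hsub hy) fun h => hyc (subset_closure h), norm_zero]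
      exact le_max_right _ _

/-- The maximum principle for the components of a viscosity solution in its positivity set. -/
theorem inner_le_of_viscosity [NeZero n] (hU : IsViscositySolution (ball 0 1) U) {R : ℝ}
    (hR : R < 1) (f : Euc m) {φ : MvPolynomial (Fin n) ℝ}
    (hlap : ∀ x ∈ ball (0 : Euc n) R, peval (lapP φ) x ≤ 0)
    (hfb : ∀ x ∈ freeBoundary (ball 0 1) U, x ∈ closedBall (0 : Euc n) R → 0 ≤ peval φ x)
    (hs : ∀ x ∈ sphere (0 : Euc n) R, x ∈ closure (positivitySet (ball 0 1) U) →
      inner ℝ (U x) f ≤ peval φ x) :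
    ∀ x ∈ closedBall (0 : Euc n) R, x ∈ closure (positivitySet (ball 0 1) U) →
      inner ℝ (U x) f ≤ peval φ x := by
  have hsub : closedBall (0 : Euc n) R ⊆ ball 0 1 := closedBall_subset_ball hR
  set K := closedBall (0 : Euc n) R ∩ closure (positivitySet (ball 0 1) U)
  have hK : IsCompact K := (isCompact_closedBall _ _).inter_right isClosed_closure
  have key := nonpos_of_subharmonic hK (f := (fun y => inner ℝ (U y) f) - peval φ)
    (((hU.continuousOn.mono (inter_subset_left.trans hsub)).inner continuousOn_const).sub
      (continuous_peval φ).continuousOn) (by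
    rintro x ⟨hx, hxc⟩
    rcases (mem_closedBall.1 hx).eq_or_lt with h | h
    · left
      simpa using hs x h hxc
    · by_cases hP : x ∈ positivitySet (ball 0 1) U
      · right
        have hh := harmonicAt_inner (fun i => hU.harmonic i x hP) f
        refine ⟨inter_mem (closedBall_mem_nhds_of_mem h) (mem_of_superset
          ((isOpen_positivitySet isOpen_ball hU.continuousOn).mem_nhds hP) subset_closure),
          hh.1.sub (contDiffAt_peval φ x), ?_⟩
        rw [hh.1.laplacian_sub (contDiffAt_peval φ x), laplacian_peval,
          show Laplacian.laplacian (fun y => inner ℝ (U y) f) x = 0 from hh.2.self_of_nhds]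
        linarith [hlap x h]
      · left
        have := hfb x (mem_freeBoundary_of_mem_closure (hsub hx) hxc hP) hx
        simpa [eq_zero_of_notMem_positivitySet (hsub hx) hP] using this)
  intro x hx hxc
  simpa using key x ⟨hx, hxc⟩

end comparison

/-! ### Lipschitz data on the sphere -/

/-- Multiply v by a cutoff vanishing for heights at most δ and equal to 1 from 2δ on, then extend by
parity. The cutoff confines v to heights where interior estimates hold, so the Lipschitz constant is
uniform in v. -/
theorem exists_symmetric_data [NeZero n] (i₀ : Fin n) {δ : ℝ} (hδ : 0 < δ) (hδ1 : δ ≤ 1) :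
    ∃ L : ℝ, ∀ v : Euc n → ℝ, HarmonicOnNhd v {x | x ∈ ball (0 : Euc n) 1 ∧ δ / 2 < x i₀} →
      (∀ x ∈ ball (0 : Euc n) 1, δ / 2 < x i₀ → |v x| ≤ 1) → ∀ s : ℝ, s = 1 ∨ s = -1 →
      ∃ g : Euc n → ℝ, (∀ x ∈ sphere (0 : Euc n) (1 / 2), |g x| ≤ 1) ∧
        (∀ x ∈ sphere (0 : Euc n) (1 / 2), ∀ y ∈ sphere (0 : Euc n) (1 / 2),
          |g x - g y| ≤ L * ‖x - y‖) ∧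
        (∀ x ∈ sphere (0 : Euc n) (1 / 2), g (hrefl i₀ x) = s * g x) ∧
        (∀ x ∈ sphere (0 : Euc n) (1 / 2), 2 * δ ≤ x i₀ → g x = v x) := by
  -- For close points, 4n/δ comes from the interior estimate with radius δ/4 and 1/δ from the
  -- cutoff. For points at distance at least δ/8, the bound 2 on the oscillation needs at most 16/δ.
  refine ⟨(4 * n + 17) / δ, fun v hv hv1 s hs => ?_⟩
  have hsa : |s| = 1 := by rcases hs with rfl | rfl <;> norm_num
  have hss : s * s = 1 := by rcases hs with rfl | rfl <;> norm_num
  set χ : ℝ → ℝ := fun t => max 0 (min 1 (t / δ - 1))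
  have hχ0 : ∀ t, 0 ≤ χ t := fun t => le_max_left _ _
  have hχ1 : ∀ t, χ t ≤ 1 := fun t => max_le zero_le_one (min_le_left _ _)
  have hχz : ∀ t, t ≤ δ → χ t = 0 := fun t ht => by
    have : t / δ - 1 ≤ 0 := by rw [sub_nonpos, div_le_one hδ]; exact ht
    exact max_eq_left ((min_le_right _ _).trans this)
  have hχo : ∀ t, 2 * δ ≤ t → χ t = 1 := fun t ht => by
    have : 1 ≤ t / δ - 1 := by rw [le_sub_iff_add_le, le_div_iff₀ hδ]; linarith
    simp only [χ, min_eq_left this]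
    norm_num
  have hχL : ∀ t t', |χ t - χ t'| ≤ |t - t'| / δ := fun t t' => by
    have h1 := abs_max_sub_max_le_max 0 (min 1 (t / δ - 1)) 0 (min 1 (t' / δ - 1))
    have h2 := abs_min_sub_min_le_max 1 (t / δ - 1) 1 (t' / δ - 1)
    simp only [sub_self, abs_zero] at h1 h2
    rw [max_eq_right (abs_nonneg (min 1 (t / δ - 1) - min 1 (t' / δ - 1)))] at h1
    rw [max_eq_right (abs_nonneg (t / δ - 1 - (t' / δ - 1)))] at h2
    refine (h1.trans h2).trans (le_of_eq ?_)
    rw [← abs_of_pos hδ, ← abs_div, abs_of_pos hδ]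
    congr 1
    ring
  have hup : ∀ z w : Euc n, ‖z‖ = 1 / 2 → ‖w‖ = 1 / 2 → 7 / 8 * δ ≤ z i₀ → 7 / 8 * δ ≤ w i₀ →
      ‖z - w‖ < δ / 8 → |χ (z i₀) * v z - χ (w i₀) * v w| ≤ (4 * n + 1) / δ * ‖z - w‖ := by
    intro z w hz hw hz0 hw0 hzw
    have hcoord : (midpoint ℝ z w) i₀ = (z i₀ + w i₀) / 2 := by
      rw [midpoint_eq_smul_add, invOf_eq_inv]; simp; ring
    have hmn : ‖midpoint ℝ z w‖ ≤ 1 / 2 := by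
      rw [midpoint_eq_smul_add, invOf_eq_inv, norm_smul]
      have := norm_add_le z w
      norm_num
      linarith
    have hmem : ∀ y ∈ closedBall (midpoint ℝ z w) (δ / 4), y ∈ ball (0 : Euc n) 1 ∧
        δ / 2 < y i₀ := by
      intro y hy
      refine ⟨?_, ?_⟩
      · have := closedBall_subset_of_norm_le hmn (le_refl (1 / 2 + δ / 4)) hy
        rw [mem_closedBall_zero_iff] at this
        rw [mem_ball_zero_iff]
        linarith
      · have h1 := abs_coord_le (y - midpoint ℝ z w) i₀
        rw [mem_closedBall, dist_eq_norm] at hy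
        rw [PiLp.sub_apply, hcoord] at h1
        have := (abs_le.1 (h1.trans hy)).1
        linarith
    have h1 := harmonic_lipschitz (x := z) (y := w) (by positivity : 0 < δ / 4)
      (fun y hy => hv y (hmem y hy)) (fun y hy => hv1 y (hmem y hy).1 (hmem y hy).2) (by linarith)
    have h2 := (hχL (z i₀) (w i₀)).trans (div_le_div_of_nonneg_right
      (by simpa using abs_coord_le (z - w) i₀) hδ.le)
    have hvz := hv1 z (by rw [mem_ball_zero_iff, hz]; norm_num) (by linarith)
    have e : χ (z i₀) * v z - χ (w i₀) * v w =
        (χ (z i₀) - χ (w i₀)) * v z + χ (w i₀) * (v z - v w) := by ring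
    rw [e]
    refine (abs_add_le _ _).trans ?_
    rw [abs_mul, abs_mul, abs_of_nonneg (hχ0 _)]
    have h3 : |χ (z i₀) - χ (w i₀)| * |v z| ≤ ‖z - w‖ / δ * 1 :=
      mul_le_mul h2 hvz (abs_nonneg _) (by positivity)
    have h4 : χ (w i₀) * |v z - v w| ≤ 1 * (n * 1 / (δ / 4) * ‖z - w‖) :=
      mul_le_mul (hχ1 _) h1 (abs_nonneg _) zero_le_one
    have h5 : (4 * n + 1) / δ * ‖z - w‖ =
      ‖z - w‖ / δ * 1 + 1 * (n * 1 / (δ / 4) * ‖z - w‖) := by field_simp; ring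
    linarith
  set g : Euc n → ℝ := fun x => χ |x i₀| * (if 0 ≤ x i₀ then v x else s * v (hrefl i₀ x))
  have hgpos : ∀ x, 0 ≤ x i₀ → g x = χ (x i₀) * v x := fun x hx => by
    simp [g, hx, abs_of_nonneg hx]
  have hgs : ∀ x, g (hrefl i₀ x) = s * g x := by
    intro x
    rcases lt_trichotomy (x i₀) 0 with h | h | h
    · simp [g, h.le, h.not_ge]
      linear_combination (-(χ |x i₀|) * v (hrefl i₀ x)) * hss
    · simp [g, h, hχz 0 hδ.le]
    · simp [g, h.le, h.not_ge]
      ring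
  have hg1 : ∀ x ∈ sphere (0 : Euc n) (1 / 2), |g x| ≤ 1 := by
    have hpos : ∀ x ∈ sphere (0 : Euc n) (1 / 2), 0 ≤ x i₀ → |g x| ≤ 1 := by
      intro x hx h0
      rw [hgpos x h0, abs_mul, abs_of_nonneg (hχ0 _)]
      rcases le_or_gt (x i₀) δ with h | h
      · rw [hχz _ h]; simp
      · have := hv1 x (sphere_subset_closedBall.trans (closedBall_subset_ball (by norm_num)) hx)
          (by linarith)
        exact mul_le_one₀ (hχ1 _) (abs_nonneg _) this
    intro x hx
    rcases le_total 0 (x i₀) with h | h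
    · exact hpos x hx h
    · have := hpos (hrefl i₀ x) (by simpa using hx) (by simpa using h)
      rwa [hgs, abs_mul, hsa, one_mul] at this
  refine ⟨g, hg1, ?_, fun x _ => hgs x, ?_⟩
  · intro x hx y hy
    have hx2 : ‖x‖ = 1 / 2 := by simpa using hx
    have hy2 : ‖y‖ = 1 / 2 := by simpa using hy
    rcases le_or_gt (δ / 8) ‖x - y‖ with hfar | hnear
    · have h1 := abs_sub (g x) (g y)
      have h2 := hg1 x hx
      have h3 := hg1 y hy
      have h4 : 2 ≤ (4 * n + 17) / δ * ‖x - y‖ := by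
        rw [div_mul_eq_mul_div, le_div_iff₀ hδ]
        have : (0 : ℝ) ≤ n * ‖x - y‖ := by positivity
        nlinarith
      linarith
    · have hco := abs_le.1 ((abs_coord_le (x - y) i₀).trans hnear.le)
      rw [PiLp.sub_apply] at hco
      have hL : (4 * n + 1) / δ * ‖x - y‖ ≤ (4 * n + 17) / δ * ‖x - y‖ := by gcongr; norm_num
      by_cases hsmall : |x i₀| ≤ δ ∧ |y i₀| ≤ δ
      · have e1 : g x = 0 := by simp [g, hχz _ hsmall.1]
        have e2 : g y = 0 := by simp [g, hχz _ hsmall.2]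
        rw [e1, e2]
        simp
        positivity
      -- Two points closer than δ/8, not both in the dead zone of the cutoff, lie on one side at
      -- height at least 7δ/8. A ball of radius δ/4 about their midpoint then stays above height
      -- δ/2.
      · have hcase : (7 / 8 * δ ≤ x i₀ ∧ 7 / 8 * δ ≤ y i₀) ∨
            (x i₀ ≤ -(7 / 8 * δ) ∧ y i₀ ≤ -(7 / 8 * δ)) := by
          rw [abs_le, abs_le] at hsmall
          by_contra hcon
          apply hsmall
          rw [not_or, not_and_or, not_and_or, not_le, not_le, not_le, not_le] at hcon
          rcases hcon with ⟨h1 | h1, h2 | h2⟩ <;>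
            exact ⟨⟨by linarith, by linarith⟩, ⟨by linarith, by linarith⟩⟩
        rcases hcase with ⟨h1, h2⟩ | ⟨h1, h2⟩
        · rw [hgpos x (by linarith), hgpos y (by linarith)]
          exact (hup x y hx2 hy2 h1 h2 hnear).trans hL
        · have h3 := hup (hrefl i₀ x) (hrefl i₀ y) (by simpa using hx2) (by simpa using hy2)
            (by simp; linarith) (by simp; linarith) (by rwa [← hrefl_sub, norm_hrefl])
          rw [← hgpos _ (by simp; linarith), ← hgpos _ (by simp; linarith), hgs, hgs, ← mul_sub,
            abs_mul, hsa, one_mul, ← hrefl_sub, norm_hrefl] at h3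
          exact h3.trans hL
  · intro x _ h
    rw [hgpos x (by linarith), hχo _ h, one_mul]

end

noncomputable section
open MvPolynomial
variable {n : ℕ}

/-! ### Sums of bounded polynomials and increments off the hyperplane -/

theorem PolyBound.add {P Q : MvPolynomial (Fin n) ℝ} {R M M' : ℝ} (hP : PolyBound P R M)
    (hQ : PolyBound Q R M') : PolyBound (P + Q) R (M + M') :=
  ⟨fun x hx => by
    rw [peval_add]; exact (abs_add_le _ _).trans (add_le_add (hP.zero x hx) (hQ.zero x hx)),
  fun x hx i => by
    rw [map_add, peval_add]
    exact (abs_add_le _ _).trans (add_le_add (hP.one x hx i) (hQ.one x hx i)),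
  fun x hx i j => by
    rw [map_add, map_add, peval_add]
    exact (abs_add_le _ _).trans (add_le_add (hP.two x hx i j) (hQ.two x hx i j))⟩

theorem PolyBound.neg {P : MvPolynomial (Fin n) ℝ} {R M : ℝ} (hP : PolyBound P R M) :
    PolyBound (-P) R M :=
  ⟨fun x hx => by rw [peval_neg, abs_neg]; exact hP.zero x hx,
  fun x hx i => by rw [map_neg, peval_neg, abs_neg]; exact hP.one x hx i,
  fun x hx i j => by rw [map_neg, map_neg, peval_neg, abs_neg]; exact hP.two x hx i j⟩

/-- A bound for the increment in a coordinate direction. -/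
theorem exists_proj_abs_sub_le (i₀ : Fin n) {R : ℝ} {x : Euc n} (hx : x ∈ closedBall 0 R) :
    ∃ y ∈ closedBall (0 : Euc n) R, y i₀ = 0 ∧ ∀ (Q : MvPolynomial (Fin n) ℝ) (M : ℝ),
      (∀ z ∈ closedBall (0 : Euc n) R, |peval (pderiv i₀ Q) z| ≤ M) →
      |peval Q x - peval Q y| ≤ M * |x i₀| := by
  set e : Euc n := EuclideanSpace.single i₀ 1
  set y : Euc n := (1 / 2 : ℝ) • (x + hrefl i₀ x)
  have hy0 : y i₀ = 0 := by simp [y]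
  have hyR : y ∈ closedBall (0 : Euc n) R := by
    have hx : ‖x‖ ≤ R := by simpa using hx
    rw [mem_closedBall_zero_iff, norm_smul]
    have := norm_add_le x (hrefl i₀ x)
    rw [norm_hrefl] at this
    norm_num
    linarith
  have hxy : y + x i₀ • e = x := by
    ext j
    by_cases h : j = i₀
    · subst h; simp [y, e]
    · simp [y, e, h]; ring
  refine ⟨y, hyR, hy0, fun Q M hM => ?_⟩
  have hl : ∀ t : ℝ, HasDerivAt (fun t : ℝ => y + t • e) e t := fun t => by
    simpa using ((hasDerivAt_id t).smul_const e).const_add y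
  have hd : ∀ t : ℝ, HasDerivAt (fun t => peval Q (y + t • e)) (peval (pderiv i₀ Q) (y + t • e))
      t := fun t => by
    refine ((hasFDerivAt_peval Q _).comp_hasDerivAt t (hl t)).congr_deriv ?_
    simp [e, sum_apply]
  set s : Set ℝ := {t | y + t • e ∈ closedBall (0 : Euc n) R}
  have hs : Convex ℝ s := by
    intro a ha b hb c d hc hd hcd
    have := convex_closedBall (0 : Euc n) R ha hb hc hd hcd
    have e1 : y + (c • a + d • b) • e = c • (y + a • e) + d • (y + b • e) := by
      have e2 : y = c • y + d • y := by rw [← add_smul, hcd, one_smul]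
      nth_rewrite 1 [e2]
      simp only [smul_eq_mul]
      module
    change y + (c • a + d • b) • e ∈ closedBall (0 : Euc n) R
    rwa [e1]
  have := hs.norm_image_sub_le_of_norm_hasDerivWithin_le (f := fun t => peval Q (y + t • e))
    (x := 0) (y := x i₀) (fun t _ => (hd t).hasDerivWithinAt) (fun t ht => hM _ ht)
    (by
      change y + (0 : ℝ) • e ∈ closedBall (0 : Euc n) R
      rwa [zero_smul, add_zero]) (by
      change y + x i₀ • e ∈ closedBall (0 : Euc n) R
      rwa [hxy])
  simpa [hxy] using this

/-! ### Flat solutions -/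

/-- The hypotheses of the improvement of flatness. -/
structure IsFlatSolution {d k : ℕ} (ε : ℝ) (U : Euc (d + 1) → Euc (k + 1)) : Prop where
  visc : IsViscositySolution (ball 0 1) U
  flat : ∀ x ∈ ball (0 : Euc (d + 1)) 1, ‖U x - max (x (Fin.last d)) 0 • fFirst k‖ ≤ ε
  zero : ∀ x ∈ ball (0 : Euc (d + 1)) 1, x (Fin.last d) < -ε → ‖U x‖ = 0
  origin : (0 : Euc (d + 1)) ∈ freeBoundary (ball 0 1) U

namespace IsFlatSolution
variable {d k : ℕ} {ε : ℝ} {U : Euc (d + 1) → Euc (k + 1)} (h : IsFlatSolution ε U)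
include h

theorem norm_le {x : Euc (d + 1)} (hx : x ∈ ball (0 : Euc (d + 1)) 1) :
    ‖U x‖ ≤ max (x (Fin.last d)) 0 + ε := by
  have h1 := norm_le_norm_add_norm_sub' (U x) (max (x (Fin.last d)) 0 • fFirst k)
  have h2 : ‖max (x (Fin.last d)) 0 • fFirst k‖ = max (x (Fin.last d)) 0 := by
    rw [norm_smul, fFirst]
    simp
  have := h.flat x hx
  linarith

theorem abs_first_sub_le {x : Euc (d + 1)} (hx : x ∈ ball (0 : Euc (d + 1)) 1) :
    |U x 0 - max (x (Fin.last d)) 0| ≤ ε := by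
  have h1 := (abs_coord_le (U x - max (x (Fin.last d)) 0 • fFirst k) 0).trans (h.flat x hx)
  simpa [fFirst] using h1

theorem abs_apply_le {x : Euc (d + 1)} (hx : x ∈ ball (0 : Euc (d + 1)) 1) {j : Fin (k + 1)}
    (hj : j ≠ 0) : |U x j| ≤ ε := by
  have h1 := (abs_coord_le (U x - max (x (Fin.last d)) 0 • fFirst k) j).trans (h.flat x hx)
  simpa [fFirst, hj] using h1

/-- The components other than the first contribute at most ε² in total; so wherever u¹ is bounded
below, |U| exceeds u¹ only by O(ε²). -/
theorem norm_sq_le {x : Euc (d + 1)} (hx : x ∈ ball (0 : Euc (d + 1)) 1) :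
    ‖U x‖ ^ 2 ≤ U x 0 ^ 2 + ε ^ 2 := by
  have h1 : ‖U x - max (x (Fin.last d)) 0 • fFirst k‖ ^ 2 ≤ ε ^ 2 :=
    pow_le_pow_left₀ (norm_nonneg _) (h.flat x hx) 2
  rw [EuclideanSpace.real_norm_sq_eq, Fin.sum_univ_succ] at h1 ⊢
  simp only [fFirst, PiLp.sub_apply, PiLp.smul_apply, PiLp.single_apply,
    Fin.succ_ne_zero, if_false, smul_zero, sub_zero] at h1
  nlinarith [sq_nonneg (U x 0 - max (x (Fin.last d)) 0 • (if (0 : Fin (k + 1)) = 0 then (1 : ℝ)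
    else 0))]

theorem mem_positivitySet {x : Euc (d + 1)} (hx : x ∈ ball (0 : Euc (d + 1)) 1)
    (hε : ε < x (Fin.last d)) : x ∈ positivitySet (ball 0 1) U := by
  refine ⟨hx, ?_⟩
  have h1 := abs_le.1 (h.abs_first_sub_le hx)
  have h2 := abs_coord_le (U x) 0
  have h3 := le_max_left (x (Fin.last d)) 0
  have h4 := le_abs_self (U x 0)
  linarith

theorem neg_le_of_mem_closure {x : Euc (d + 1)}
    (hx : x ∈ closure (positivitySet (ball 0 1) U)) : -ε ≤ x (Fin.last d) := by
  have hc : IsClosed {x : Euc (d + 1) | -ε ≤ x (Fin.last d)} :=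
    isClosed_le continuous_const (by fun_prop)
  have hs : positivitySet (ball 0 1) U ⊆ {x : Euc (d + 1) | -ε ≤ x (Fin.last d)} := by
    rintro y ⟨hy, hpos⟩
    by_contra hlt
    have : y (Fin.last d) < -ε := not_le.1 hlt
    exact hpos.ne' (h.zero y hy this)
  exact closure_minimal hs hc hx

theorem abs_le_of_mem_freeBoundary {x : Euc (d + 1)} (hx : x ∈ freeBoundary (ball 0 1) U) :
    |x (Fin.last d)| ≤ ε := by
  refine abs_le.2 ⟨h.neg_le_of_mem_closure hx.2.1, ?_⟩
  by_contra! hlt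
  exact notMem_positivitySet_of_mem_freeBoundary isOpen_ball h.visc.continuousOn hx
    (h.mem_positivitySet hx.1 hlt)

theorem origin_eq_zero : U 0 = 0 :=
  eq_zero_of_notMem_positivitySet h.origin.1
    (notMem_positivitySet_of_mem_freeBoundary isOpen_ball h.visc.continuousOn h.origin)

end IsFlatSolution

end

noncomputable section
open MvPolynomial
variable {d k : ℕ}

/-! ### Linear approximation of flat solutions -/

theorem lapP_X (i : Fin (d + 1)) : lapP (X i : MvPolynomial (Fin (d + 1)) ℝ) = 0 := by
  simp [lapP_apply, pderiv_X, Pi.single_apply, apply_ite]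

/-- A corrector: a small polynomial which is strictly superharmonic, has negative normal derivative
on the hyperplane `x_n = 0` and is large near the equator of the sphere of radius `1 / 2`. -/
structure IsCorrector (d : ℕ) (c : MvPolynomial (Fin (d + 1)) ℝ) (σ δ : ℝ) : Prop where
  lap : lapP c = C (-2 * σ)
  normal : ∀ y : Euc (d + 1), y (Fin.last d) = 0 → peval (pderiv (Fin.last d) c) y = -σ
  two_mul_le : ∀ x ∈ closedBall (0 : Euc (d + 1)) (1 / 2), 2 * σ ≤ peval c x
  equator : ∀ x ∈ sphere (0 : Euc (d + 1)) (1 / 2), |x (Fin.last d)| ≤ 2 * δ →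
    4 + 2 * σ ≤ peval c x
  le_inside : ∀ x ∈ closedBall (0 : Euc (d + 1)) (1 / 4), peval c x ≤ 5 * σ

theorem exists_isCorrector (d : ℕ) {σ : ℝ} (hσ : 0 < σ) :
    ∃ c δ, 0 < δ ∧ δ ≤ 1 ∧ IsCorrector d c σ δ := by
  set i₀ := Fin.last d
  obtain ⟨b, δ', hδ', hb0, hbe, hbp, hb4, hbi⟩ :=
    exists_equatorial_barrier i₀ (by norm_num : (0 : ℝ) < 1 / 2) hσ
  -- With t = x_n, the term σ(1 - t - t²) has Laplacian -2σ and normal derivative -σ at t = 0, to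
  -- which the even `b` adds nothing. For |t| ≤ 1/2 it lies between 0 and 5σ/4, whence the final
  -- bound 5σ.
  set c : MvPolynomial (Fin (d + 1)) ℝ := b + C (2 * σ) + σ • (1 - X i₀ - X i₀ ^ 2)
  have hc : ∀ x, peval c x = peval b x + 2 * σ + σ * (1 - x i₀ - x i₀ ^ 2) := fun x => by simp [c]
  have hk0 : ∀ x ∈ closedBall (0 : Euc (d + 1)) (1 / 2),
      0 ≤ σ * (1 - x i₀ - x i₀ ^ 2) ∧ σ * (1 - x i₀ - x i₀ ^ 2) ≤ σ * (5 / 4) := fun x hx => by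
    have := abs_le.1 ((abs_coord_le x i₀).trans (show ‖x‖ ≤ 1 / 2 by simpa using hx))
    exact ⟨mul_nonneg hσ.le (by nlinarith), mul_le_mul_of_nonneg_left (by nlinarith) hσ.le⟩
  refine ⟨c, min (δ' / 2) 1, by positivity, min_le_right _ _, ?_, ?_, ?_, ?_, ?_⟩
  · have h2 : lapP (X i₀ ^ 2 : MvPolynomial (Fin (d + 1)) ℝ) = C 2 := by
      rw [pow_two, lapP_X_mul, lapP_X, pderiv_X_self, smul_eq_C_mul]; simp
    have h3 : lapP (1 : MvPolynomial (Fin (d + 1)) ℝ) = 0 := lapP_C 1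
    simp only [c]
    rw [map_add, map_add, map_smul, map_sub, map_sub, hb0, lapP_C, lapP_X, h2, h3, smul_eq_C_mul]
    simp only [map_mul, map_neg]
    ring
  · intro y hy
    simp [c, pderiv_eq_zero_of_even hbe hy, i₀, hy]
  · intro x hx
    rw [hc]
    linarith [(hk0 x hx).1, hbp x hx]
  · intro x hx hxδ
    rw [hc]
    have := hb4 x hx (hxδ.trans (by linarith [min_le_left (δ' / 2) 1]))
    linarith [(hk0 x (sphere_subset_closedBall hx)).1]
  · intro x hx
    rw [hc]
    have h1 := (abs_le.1 (hbi x (by norm_num; simpa using hx))).2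
    linarith [(hk0 x (closedBall_subset_closedBall (by norm_num) hx)).2]

/-- To first order in ε only the sign of ∂_n H decides whether the slope is above or below 1. -/
theorem norm_gradient_sq_add_smul (i₀ : Fin (d + 1)) (ε : ℝ) (H : MvPolynomial (Fin (d + 1)) ℝ)
    (x : Euc (d + 1)) : ‖∇ (peval (X i₀ + ε • H)) x‖ ^ 2 =
      1 + 2 * ε * peval (pderiv i₀ H) x + ε ^ 2 * ∑ i, peval (pderiv i H) x ^ 2 := by
  rw [norm_gradient_peval_sq]
  have h1 : ∀ i, peval (pderiv i (X i₀ + ε • H)) x ^ 2 =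
      (if i = i₀ then 1 + 2 * ε * peval (pderiv i H) x else 0) +
        ε ^ 2 * peval (pderiv i H) x ^ 2 := fun i => by
    by_cases hi : i = i₀
    · subst hi
      simp only [map_add, Derivation.map_smul, pderiv_X_self, peval_add, peval_one, peval_smul,
        if_true]
      ring
    · simp only [map_add, Derivation.map_smul, pderiv_X_of_ne (Ne.symm hi), peval_add,
        peval_zero, peval_smul, if_neg hi]
      ring
  simp only [h1, Finset.sum_add_distrib, ← Finset.mul_sum]
  simp

/-! ### Trapping a flat solution between corrected harmonic polynomials -/

section comparison
variable {ε σ δ M : ℝ} {U : Euc (d + 1) → Euc (k + 1)} {c h : MvPolynomial (Fin (d + 1)) ℝ}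

theorem lapP_X_add_smul (hc : IsCorrector d c σ δ) (hh0 : lapP h = 0) (s : ℝ)
    (x : Euc (d + 1)) :
    peval (lapP (X (Fin.last d) + ε • (h + s • c))) x = ε * (s * (-2 * σ)) := by
  rw [map_add, map_smul, map_add, map_smul, lapP_X, hh0, hc.lap]
  simp

/-- On {x_n = 0} the normal derivative is exactly -sσ, because h is even. The free boundary is
within ε of that hyperplane, and the second derivative bound `M` allows a change of at most Mε ≤
σ/2. -/
theorem abs_normal_derivative_le (hU : IsFlatSolution ε U) (hc : IsCorrector d c σ δ)
    (hhe : reflP (Fin.last d) h = h) {s : ℝ} (hM0 : 0 ≤ M)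
    (hM : PolyBound (h + s • c) (1 / 2) M) (hε : M * ε ≤ σ / 2)
    {x : Euc (d + 1)} (hx : x ∈ freeBoundary (ball 0 1) U)
    (hxR : x ∈ closedBall (0 : Euc (d + 1)) (1 / 2)) :
    |peval (pderiv (Fin.last d) (h + s • c)) x + s * σ| ≤ σ / 2 := by
  obtain ⟨y, hy, hy0, hyQ⟩ := exists_proj_abs_sub_le (Fin.last d) hxR
  have h1 := hyQ (pderiv (Fin.last d) (h + s • c)) M fun z hz => hM.two z hz _ _
  have h2 : peval (pderiv (Fin.last d) (h + s • c)) y = -(s * σ) := by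
    rw [map_add, peval_add, pderiv_eq_zero_of_even hhe hy0, Derivation.map_smul, peval_smul,
      hc.normal y hy0]
    ring
  rw [h2, sub_neg_eq_add] at h1
  exact h1.trans ((mul_le_mul_of_nonneg_left (hU.abs_le_of_mem_freeBoundary hx) hM0).trans hε)

/-- The function x_n + ε(h - c) is a strict subsolution: its Laplacian is 2εσ and its slope on F(U)
exceeds 1. On the sphere, c ≥ 2σ beats the approximation error at heights at least 2δ, c ≥ 4 + 2σ
beats everything near the equator, and below height -2δ the function is negative while U = 0. -/
theorem lower_bound_of_approx (hU : IsFlatSolution ε U) (hc : IsCorrector d c σ δ) (hσ : 0 < σ)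
    (hσ1 : σ ≤ 1 / 10) (hε : 0 < ε) (hεδ : ε ≤ δ)
    (hh0 : lapP h = 0) (hhe : reflP (Fin.last d) h = h)
    (hh1 : ∀ x ∈ sphere (0 : Euc (d + 1)) (1 / 2), |peval h x| ≤ 1 + σ)
    (hhU : ∀ x ∈ sphere (0 : Euc (d + 1)) (1 / 2), 2 * δ ≤ x (Fin.last d) →
      |x (Fin.last d) + ε * peval h x - U x 0| ≤ ε * σ)
    (hM0 : 0 ≤ M) (hM : PolyBound (h + (-1 : ℝ) • c) (1 / 2) M) (hεM : M * ε ≤ σ / 2) :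
    ∀ x ∈ closedBall (0 : Euc (d + 1)) (1 / 2),
      x (Fin.last d) + ε * (peval h x - peval c x) ≤ U x 0 := by
  have hinner : ∀ x, inner ℝ (U x) (fFirst k) = U x 0 := fun x => by
    simp [fFirst, EuclideanSpace.inner_single_right]
  have key := peval_le_of_viscosity hU.visc (by norm_num : (1 / 2 : ℝ) < 1)
    (f := fFirst k) (by simp [fFirst]) (φ := X (Fin.last d) + ε • (h + (-1 : ℝ) • c))
    (fun x _ => by rw [lapP_X_add_smul hc hh0]; nlinarith [mul_pos hε hσ]) (by
      intro x hx hxR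
      have h2 := (abs_le.1 (abs_normal_derivative_le hU hc hhe hM0 hM hεM hx
        (ball_subset_closedBall hxR))).1
      have h4 : 0 ≤ ε ^ 2 * ∑ i, peval (pderiv i (h + (-1 : ℝ) • c)) x ^ 2 := by positivity
      have h5 : 0 < ε * peval (pderiv (Fin.last d) (h + (-1 : ℝ) • c)) x :=
        mul_pos hε (by linarith)
      rw [← one_lt_sq_iff₀ (norm_nonneg _), norm_gradient_sq_add_smul]
      linarith) (by
      intro x hx
      have hxb : x ∈ ball (0 : Euc (d + 1)) 1 :=
        closedBall_subset_ball (by norm_num) (sphere_subset_closedBall hx)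
      have h1 := hc.two_mul_le x (sphere_subset_closedBall hx)
      have h3 := abs_le.1 (hh1 x hx)
      have h4 := abs_le.1 (hU.abs_first_sub_le hxb)
      rw [hinner]
      simp only [peval_add, peval_X, peval_smul]
      rcases le_or_gt (2 * δ) (x (Fin.last d)) with hc1 | hc1
      · have h6 := (abs_le.1 (hhU x hx hc1)).2
        have : ε * (2 * σ) ≤ ε * peval c x := mul_le_mul_of_nonneg_left h1 hε.le
        have : 0 < ε * σ := mul_pos hε hσ
        linarith
      · rcases le_or_gt (-(2 * δ)) (x (Fin.last d)) with hc3 | hc3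
        · have h6 := hc.equator x hx (abs_le.2 ⟨by linarith, by linarith⟩)
          have h7 : ε * (peval h x + -1 * peval c x) ≤ ε * -1 :=
            mul_le_mul_of_nonneg_left (by linarith) hε.le
          have h8 := le_max_left (x (Fin.last d)) 0
          linarith
        · have h6 : U x 0 = 0 := by
            have := norm_eq_zero.1 (hU.zero x hxb (by linarith))
            simp [this]
          rw [h6]
          have h7 : ε * (peval h x + -1 * peval c x) ≤ ε * 2 :=
            mul_le_mul_of_nonneg_left (by linarith) hε.le
          linarith)
  intro x hx
  have h1 := key x hx
  rw [hinner] at h1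
  simp only [peval_add, peval_X, peval_smul] at h1
  linarith

/-- The mirror image of the lower bound, with two additions. The quadratic term of the squared slope
must stay below the gain εσ, hence the condition on M²ε. And |U| replaces u¹: at heights at least 2δ
one has u¹ ≥ δ, so ε ≤ 2δσ gives |U| ≤ u¹ + εσ. -/
theorem upper_bound_of_approx (hU : IsFlatSolution ε U) (hc : IsCorrector d c σ δ) (hσ : 0 < σ)
    (hσ1 : σ ≤ 1 / 10) (hε : 0 < ε) (hεδ : ε ≤ δ) (hεσ : ε ≤ 2 * δ * σ)
    (hh0 : lapP h = 0) (hhe : reflP (Fin.last d) h = h)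
    (hh1 : ∀ x ∈ sphere (0 : Euc (d + 1)) (1 / 2), |peval h x| ≤ 1 + σ)
    (hhU : ∀ x ∈ sphere (0 : Euc (d + 1)) (1 / 2), 2 * δ ≤ x (Fin.last d) →
      |x (Fin.last d) + ε * peval h x - U x 0| ≤ ε * σ)
    (hM0 : 0 ≤ M) (hM : PolyBound (h + (1 : ℝ) • c) (1 / 2) M) (hεM : M * ε ≤ σ / 2)
    (hεM2 : (d + 1) * M ^ 2 * ε ≤ σ / 2) :
    ∀ x ∈ closedBall (0 : Euc (d + 1)) (1 / 2), x ∈ closure (positivitySet (ball 0 1) U) →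
      ‖U x‖ ≤ x (Fin.last d) + ε * (peval h x + peval c x) := by
  have key := norm_le_of_viscosity hU.visc (by norm_num : (1 / 2 : ℝ) < 1)
    (φ := X (Fin.last d) + ε • (h + (1 : ℝ) • c))
    (fun x _ => by rw [lapP_X_add_smul hc hh0]; nlinarith [mul_pos hε hσ]) (by
      intro x hx hxR
      have hxR' := ball_subset_closedBall hxR
      have h2 := (abs_le.1 (abs_normal_derivative_le hU hc hhe hM0 hM hεM hx hxR')).2
      have h3 := norm_gradient_sq_add_smul (Fin.last d) ε (h + (1 : ℝ) • c) x
      have hB := hM.one x hxR'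
      have h4 : ∑ i, peval (pderiv i (h + (1 : ℝ) • c)) x ^ 2 ≤ (d + 1) * M ^ 2 := by
        refine (Finset.sum_le_card_nsmul _ _ (M ^ 2) fun i _ => ?_).trans (by simp)
        exact sq_le_sq' (abs_le.1 (hB i)).1 (abs_le.1 (hB i)).2
      have h5 : ε ^ 2 * ∑ i, peval (pderiv i (h + (1 : ℝ) • c)) x ^ 2 ≤ ε * (σ / 2) := by
        calc _ ≤ ε ^ 2 * ((d + 1) * M ^ 2) := by gcongr
          _ = ε * ((d + 1) * M ^ 2 * ε) := by ring
          _ ≤ _ := by gcongr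
      have h10 : ε ^ 2 * peval (pderiv (Fin.last d) (h + (1 : ℝ) • c)) x ^ 2 ≤
          ε ^ 2 * ∑ i, peval (pderiv i (h + (1 : ℝ) • c)) x ^ 2 := by
        refine mul_le_mul_of_nonneg_left ?_ (by positivity)
        exact Finset.single_le_sum (f := fun i => peval (pderiv i (h + (1 : ℝ) • c)) x ^ 2)
          (fun i _ => sq_nonneg _) (Finset.mem_univ _)
      have h8 := (abs_le.1 (hB (Fin.last d))).1
      generalize peval (pderiv (Fin.last d) (h + (1 : ℝ) • c)) x = p at *
      generalize ∑ i, peval (pderiv i (h + (1 : ℝ) • c)) x ^ 2 = S at *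
      have h6 : ε * p ≤ ε * (-(σ / 2)) := mul_le_mul_of_nonneg_left (by linarith) hε.le
      have h7 := mul_pos hε hσ
      refine ⟨?_, ?_⟩
      · have h9 : ε * -M ≤ ε * p := mul_le_mul_of_nonneg_left h8 hε.le
        have h11 : 0 < (1 + ε * p) ^ 2 := by
          have : 0 < 1 + ε * p := by linarith
          positivity
        have h12 : (1 + ε * p) ^ 2 = 1 + 2 * ε * p + ε ^ 2 * p ^ 2 := by ring
        refine norm_pos_iff.2 fun hz => ?_
        rw [hz, norm_zero] at h3
        linarith
      · rw [← sq_lt_one_iff₀ (norm_nonneg _), h3]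
        linarith) (by
      intro x hx hxcl
      have hxb : x ∈ ball (0 : Euc (d + 1)) 1 :=
        closedBall_subset_ball (by norm_num) (sphere_subset_closedBall hx)
      have h1 := hc.two_mul_le x (sphere_subset_closedBall hx)
      have h3 := abs_le.1 (hh1 x hx)
      simp only [peval_add, peval_X, peval_smul]
      have hlo := hU.neg_le_of_mem_closure hxcl
      rcases le_or_gt (2 * δ) (x (Fin.last d)) with hc1 | hc1
      · have h6 := (abs_le.1 (hhU x hx hc1)).1
        have h4 := abs_le.1 (hU.abs_first_sub_le hxb)
        have h7 : δ ≤ U x 0 := by linarith [le_max_left (x (Fin.last d)) 0]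
        have h8 : ‖U x‖ ≤ U x 0 + ε * σ := by
          have hδ : 0 < δ := hε.trans_le hεδ
          refine (abs_le_of_sq_le_sq' ?_ (by have := mul_pos hε hσ; linarith)).2
          refine (hU.norm_sq_le hxb).trans ?_
          have : ε * ε ≤ ε * (2 * (U x 0) * σ) := by
            refine mul_le_mul_of_nonneg_left (hεσ.trans ?_) hε.le
            gcongr
          nlinarith [sq_nonneg (ε * σ)]
        have : ε * (2 * σ) ≤ ε * peval c x := mul_le_mul_of_nonneg_left h1 hε.le
        linarith
      · have h6 := hc.equator x hx (abs_le.2 ⟨by linarith, by linarith⟩)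
        have h7 : ε * 2 ≤ ε * (peval h x + 1 * peval c x) :=
          mul_le_mul_of_nonneg_left (by linarith) hε.le
        have h8 := hU.norm_le hxb
        have h10 : max (x (Fin.last d)) 0 ≤ x (Fin.last d) + ε :=
          max_le (by linarith) (by linarith)
        linarith)
  intro x hx hxc
  have h1 := key x hx hxc
  simp only [peval_add, peval_X, peval_smul] at h1
  linarith

/-- No slope condition is needed. The odd h vanishes on {x_n = 0}, so |h| ≤ Mε ≤ σ on the free
boundary, where c ≥ 2σ makes the barrier nonnegative while U = 0. To be used with f = ±f^j. -/
theorem apply_le_of_approx (hU : IsFlatSolution ε U) (hc : IsCorrector d c σ δ) (hσ : 0 < σ)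
    (hσ1 : σ ≤ 1 / 10) (hε : 0 < ε) (hεδ : ε ≤ δ) {f : Euc (k + 1)}
    (hf : ∀ x ∈ ball (0 : Euc (d + 1)) 1, inner ℝ (U x) f ≤ ε)
    (hh0 : lapP h = 0) (hhe : reflP (Fin.last d) h = -h)
    (hh1 : ∀ x ∈ sphere (0 : Euc (d + 1)) (1 / 2), |peval h x| ≤ 1 + σ)
    (hhU : ∀ x ∈ sphere (0 : Euc (d + 1)) (1 / 2), 2 * δ ≤ x (Fin.last d) →
      inner ℝ (U x) f ≤ ε * (peval h x + σ))
    (hM0 : 0 ≤ M) (hM : PolyBound h (1 / 2) M) (hεM : M * ε ≤ σ) :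
    ∀ x ∈ closedBall (0 : Euc (d + 1)) (1 / 2), x ∈ closure (positivitySet (ball 0 1) U) →
      inner ℝ (U x) f ≤ ε * (peval h x + peval c x) := by
  have key := inner_le_of_viscosity hU.visc (by norm_num : (1 / 2 : ℝ) < 1) f
    (φ := ε • (h + c)) (fun x _ => by
      rw [map_smul, map_add, hh0, hc.lap]
      simp only [zero_add, peval_smul, peval_C]
      nlinarith [mul_pos hε hσ]) (by
      intro x hx hxR
      obtain ⟨y, hy, hy0, hyQ⟩ := exists_proj_abs_sub_le (Fin.last d) hxR
      have h1 := hyQ h M fun z hz => hM.one z hz _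
      rw [peval_eq_zero_of_odd hhe hy0, sub_zero] at h1
      have h2 := (abs_le.1 (h1.trans (mul_le_mul_of_nonneg_left
        (hU.abs_le_of_mem_freeBoundary hx) hM0))).1
      have h3 := hc.two_mul_le x hxR
      simp only [peval_smul, peval_add]
      exact mul_nonneg hε.le (by linarith)) (by
      intro x hx hxcl
      have hxb : x ∈ ball (0 : Euc (d + 1)) 1 :=
        closedBall_subset_ball (by norm_num) (sphere_subset_closedBall hx)
      have h1 := hc.two_mul_le x (sphere_subset_closedBall hx)
      have h3 := abs_le.1 (hh1 x hx)
      have hlo := hU.neg_le_of_mem_closure hxcl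
      simp only [peval_smul, peval_add]
      rcases le_or_gt (2 * δ) (x (Fin.last d)) with hc1 | hc1
      · refine (hhU x hx hc1).trans (mul_le_mul_of_nonneg_left ?_ hε.le)
        linarith
      · have h6 := hc.equator x hx (abs_le.2 ⟨by linarith, by linarith⟩)
        refine (hf x hxb).trans ?_
        have : ε * 1 ≤ ε * (peval h x + peval c x) :=
          mul_le_mul_of_nonneg_left (by linarith) hε.le
        linarith)
  intro x hx hxc
  have h1 := key x hx hxc
  rwa [peval_smul, peval_add] at h1

end comparison

/-- Approximation of a bounded harmonic function on `{x_n > δ / 2}` by an even or odd harmonic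
polynomial on the part `{x_n ≥ 2 δ}` of the sphere, with uniform bounds. -/
theorem exists_symmetric_approx (d : ℕ) {δ σ : ℝ} (hδ : 0 < δ) (hδ1 : δ ≤ 1) (hσ : 0 < σ)
    (hσ1 : σ ≤ 1) {s : ℝ} (hs : s = 1 ∨ s = -1) :
    ∃ M : ℝ, 0 < M ∧ ∀ v : Euc (d + 1) → ℝ,
      HarmonicOnNhd v {x | x ∈ ball (0 : Euc (d + 1)) 1 ∧ δ / 2 < x (Fin.last d)} →
      (∀ x ∈ ball (0 : Euc (d + 1)) 1, δ / 2 < x (Fin.last d) → |v x| ≤ 1) →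
      ∃ h : MvPolynomial (Fin (d + 1)) ℝ, lapP h = 0 ∧ reflP (Fin.last d) h = s • h ∧
        PolyBound h (1 / 2) M ∧ (∀ x ∈ sphere (0 : Euc (d + 1)) (1 / 2), |peval h x| ≤ 1 + σ) ∧
        (∀ x ∈ closedBall (0 : Euc (d + 1)) (1 / 2), |peval h x| ≤ 2) ∧
        ∀ x ∈ sphere (0 : Euc (d + 1)) (1 / 2), 2 * δ ≤ x (Fin.last d) →
          |peval h x - v x| ≤ σ := by
  obtain ⟨L, hL⟩ := exists_symmetric_data (Fin.last d) hδ hδ1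
  obtain ⟨M, hM0, hM⟩ := harmonic_net (Fin.last d) (by norm_num : (0 : ℝ) < 1 / 2) L hσ hs
  refine ⟨M, hM0, fun v hv hv1 => ?_⟩
  obtain ⟨g, hg1, hgL, hgs, hgv⟩ := hL v hv hv1 s hs
  obtain ⟨h, hh0, hhe, hhg, hhM⟩ := hM g hg1 hgL hgs
  have hh2 : ∀ x ∈ sphere (0 : Euc (d + 1)) (1 / 2), |peval h x| ≤ 1 + σ := fun x hx => by
    have h1 := abs_le.1 (hhg x hx)
    have h2 := abs_le.1 (hg1 x hx)
    exact abs_le.2 ⟨by linarith, by linarith⟩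
  exact ⟨h, hh0, hhe, hhM, hh2,
    abs_peval_le_of_sphere hh0 fun x hx => (hh2 x hx).trans (by linarith),
    fun x hx hxδ => hgv x hx hxδ ▸ hhg x hx⟩

/-- Taylor expansion of the approximating polynomials. -/
theorem taylor_of_abs_le_two {h : MvPolynomial (Fin (d + 1)) ℝ} (hh0 : lapP h = 0)
    (hh2 : ∀ x ∈ closedBall (0 : Euc (d + 1)) (1 / 2), |peval h x| ≤ 2) :
    (∀ i, |peval (pderiv i h) 0| ≤ 64 * (d + 1 : ℝ) ^ 3) ∧ ∀ x : Euc (d + 1), ‖x‖ ≤ 1 / 8 →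
      |peval h x - peval h 0 - ∑ i, peval (pderiv i h) 0 * x i| ≤
        64 * (d + 1 : ℝ) ^ 3 * ‖x‖ ^ 2 := by
  -- The constant is 8n³A/R² with A = 2 and R = 1/2; the gradient bound 4n is absorbed into it.
  refine ⟨fun i => ?_, fun x hx => ?_⟩
  · refine (abs_pderiv_le hh0 (by norm_num : (0 : ℝ) < 1 / 2) hh2 i).trans ?_
    push_cast
    have : (1 : ℝ) ≤ d + 1 := by linarith [(Nat.cast_nonneg d : (0 : ℝ) ≤ d)]
    nlinarith [pow_le_pow_right₀ this (by norm_num : 1 ≤ 3)]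
  · have := harmonic_taylor hh0 (by norm_num : (0 : ℝ) < 1 / 2) hh2 (x := x)
      (hx.trans (by norm_num))
    refine this.trans (le_of_eq ?_)
    push_cast
    ring

/-- Take p = ∇h(0) for the even approximant h of (u¹ - x_n)/ε; evenness makes p tangential. The
error κ absorbs 5σ from the corrector and 5σ from h(0). -/
theorem exists_linear_approx_first (d k : ℕ) {κ : ℝ} (hκ : 0 < κ) :
    ∃ ε₀ : ℝ, 0 < ε₀ ∧ ∀ ε : ℝ, 0 < ε → ε ≤ ε₀ → ∀ U : Euc (d + 1) → Euc (k + 1),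
      IsFlatSolution ε U → ∃ p : Euc (d + 1), p (Fin.last d) = 0 ∧
        (∀ i, |p i| ≤ 64 * (d + 1 : ℝ) ^ 3) ∧ ∀ x : Euc (d + 1), ‖x‖ ≤ 1 / 8 →
          x (Fin.last d) + ε * (inner ℝ x p - 64 * (d + 1 : ℝ) ^ 3 * ‖x‖ ^ 2 - κ) ≤ U x 0 ∧
          (x ∈ closure (positivitySet (ball 0 1) U) →
            ‖U x‖ ≤ x (Fin.last d) +
              ε * (inner ℝ x p + 64 * (d + 1 : ℝ) ^ 3 * ‖x‖ ^ 2 + κ)) := by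
  set σ : ℝ := min κ 1 / 10
  have hσ : 0 < σ := by positivity
  have hσκ : 10 * σ ≤ κ := by simp only [σ]; linarith [min_le_left κ 1]
  have hσ1 : σ ≤ 1 / 10 := by simp only [σ]; linarith [min_le_right κ 1]
  obtain ⟨c, δ, hδ, hδ1, hc⟩ := exists_isCorrector d hσ
  obtain ⟨M₁, hM₁0, hM₁⟩ := exists_symmetric_approx d hδ hδ1 hσ (by linarith) (Or.inl rfl)
  obtain ⟨N, hN0, hN⟩ := exists_polyBound c (1 / 2)
  set M := M₁ + N
  have hM0 : 0 < M := by positivity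
  set ε₀ : ℝ := min (min (δ / 2) (2 * δ * σ)) (min (σ / (2 * M)) (σ / (2 * (d + 1) * M ^ 2)))
  refine ⟨ε₀, by positivity, fun ε hε hεε₀ U hU => ?_⟩
  have hε1 : ε ≤ δ / 2 := hεε₀.trans ((min_le_left _ _).trans (min_le_left _ _))
  have hε2 : ε ≤ 2 * δ * σ := hεε₀.trans ((min_le_left _ _).trans (min_le_right _ _))
  have hε3 : M * ε ≤ σ / 2 := by
    have : ε ≤ σ / (2 * M) := hεε₀.trans ((min_le_right _ _).trans (min_le_left _ _))
    rw [le_div_iff₀ (by positivity)] at this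
    linarith
  have hε4 : (d + 1) * M ^ 2 * ε ≤ σ / 2 := by
    have : ε ≤ σ / (2 * (d + 1) * M ^ 2) :=
      hεε₀.trans ((min_le_right _ _).trans (min_le_right _ _))
    rw [le_div_iff₀ (by positivity)] at this
    linarith
  set v : Euc (d + 1) → ℝ := ε⁻¹ • ((fun x => U x 0) - peval (X (Fin.last d)))
  have hv : ∀ x, U x 0 = x (Fin.last d) + ε * v x := fun x => by
    simp only [v, Pi.smul_apply, Pi.sub_apply, peval_X, smul_eq_mul]
    field_simp; ring
  obtain ⟨h, hh0, hhe, hhM, hh1, hh2, hhv⟩ := hM₁ v (by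
    rintro x ⟨hx, hxδ⟩
    exact (HarmonicAt.sub (hU.visc.harmonic 0 x (hU.mem_positivitySet hx (hε1.trans_lt hxδ)))
      (harmonicOnNhd_peval (lapP_X _) univ x (mem_univ x))).const_smul) (by
    intro x hx hxδ
    have h1 := hU.abs_first_sub_le hx
    rw [max_eq_left (by linarith), hv x, add_sub_cancel_left, abs_mul, abs_of_pos hε] at h1
    exact (mul_le_iff_le_one_right hε).1 h1)
  rw [one_smul] at hhe
  have hhU : ∀ x ∈ sphere (0 : Euc (d + 1)) (1 / 2), 2 * δ ≤ x (Fin.last d) →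
      |x (Fin.last d) + ε * peval h x - U x 0| ≤ ε * σ := fun x hx hxδ => by
    rw [hv x, add_sub_add_left_eq_sub, ← mul_sub, abs_mul, abs_of_pos hε]
    exact mul_le_mul_of_nonneg_left (hhv x hx hxδ) hε.le
  have hlow := lower_bound_of_approx hU hc hσ hσ1 hε (by linarith) hh0 hhe hh1 hhU hM0.le
    (by rw [neg_one_smul]; exact hhM.add hN.neg) hε3
  have hupp := upper_bound_of_approx hU hc hσ hσ1 hε (by linarith) hε2 hh0 hhe hh1 hhU hM0.le
    (by rw [one_smul]; exact hhM.add hN) hε3 hε4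
  obtain ⟨hgrad, htay⟩ := taylor_of_abs_le_two hh0 hh2
  -- The only use of 0 ∈ F(U) here: both bounds hold at the origin, where U = 0, so |h(0)| ≤ c(0).
  have ha : |peval h 0| ≤ 5 * σ := by
    have h1 := hlow 0 (mem_closedBall_self (by norm_num))
    have h2 := hupp 0 (mem_closedBall_self (by norm_num)) hU.origin.2.1
    have h3 := hc.le_inside 0 (mem_closedBall_self (by norm_num))
    rw [hU.origin_eq_zero] at h1 h2
    simp only [PiLp.zero_apply, zero_add, norm_zero] at h1 h2
    have h4 := nonpos_of_mul_nonpos_right h1 hε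
    have h5 := nonneg_of_mul_nonneg_right h2 hε
    exact abs_le.2 ⟨by linarith, by linarith⟩
  refine ⟨WithLp.toLp 2 fun i => peval (pderiv i h) 0, pderiv_eq_zero_of_even hhe rfl, hgrad,
    fun x hx => ?_⟩
  have hin : inner ℝ x (WithLp.toLp 2 fun i => peval (pderiv i h) 0 : Euc (d + 1)) =
      ∑ i, peval (pderiv i h) 0 * x i := by simp [PiLp.inner_apply]
  have hx4 : x ∈ closedBall (0 : Euc (d + 1)) (1 / 4) := by
    rw [mem_closedBall_zero_iff]; linarith
  have hx2 : x ∈ closedBall (0 : Euc (d + 1)) (1 / 2) :=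
    closedBall_subset_closedBall (by norm_num) hx4
  have h1 := abs_le.1 (htay x hx)
  have h2 := hc.le_inside x hx4
  have h3 := abs_le.1 ha
  rw [hin]
  refine ⟨le_trans ?_ (hlow x hx2), fun hxc => (hupp x hx2 hxc).trans ?_⟩
  · have : ε * (∑ i, peval (pderiv i h) 0 * x i - 64 * (d + 1 : ℝ) ^ 3 * ‖x‖ ^ 2 - κ) ≤
        ε * (peval h x - peval c x) := mul_le_mul_of_nonneg_left (by linarith) hε.le
    linarith
  · have : ε * (peval h x + peval c x) ≤
        ε * (∑ i, peval (pderiv i h) 0 * x i + 64 * (d + 1 : ℝ) ^ 3 * ‖x‖ ^ 2 + κ) :=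
      mul_le_mul_of_nonneg_left (by linarith) hε.le
    linarith

/-- Linear approximation of the components which vanish to first order. -/
theorem exists_linear_approx_other (d k : ℕ) {κ : ℝ} (hκ : 0 < κ) :
    ∃ ε₀ : ℝ, 0 < ε₀ ∧ ∀ ε : ℝ, 0 < ε → ε ≤ ε₀ → ∀ U : Euc (d + 1) → Euc (k + 1),
      IsFlatSolution ε U → ∀ j : Fin (k + 1), j ≠ 0 → ∃ a : ℝ, |a| ≤ 64 * (d + 1 : ℝ) ^ 3 ∧
        ∀ x : Euc (d + 1), ‖x‖ ≤ 1 / 8 → x ∈ closure (positivitySet (ball 0 1) U) →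
          |U x j - ε * (a * x (Fin.last d))| ≤
            ε * (64 * (d + 1 : ℝ) ^ 3 * ‖x‖ ^ 2 + κ) := by
  set σ : ℝ := min κ 1 / 10
  have hσ : 0 < σ := by positivity
  have hσκ : 10 * σ ≤ κ := by simp only [σ]; linarith [min_le_left κ 1]
  have hσ1 : σ ≤ 1 / 10 := by simp only [σ]; linarith [min_le_right κ 1]
  obtain ⟨c, δ, hδ, hδ1, hc⟩ := exists_isCorrector d hσ
  obtain ⟨M, hM0, hM⟩ := exists_symmetric_approx d hδ hδ1 hσ (by linarith) (Or.inr rfl)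
  refine ⟨min (δ / 2) (σ / M), by positivity, fun ε hε hεε₀ U hU j hj => ?_⟩
  have hε1 : ε ≤ δ / 2 := hεε₀.trans (min_le_left _ _)
  have hε3 : M * ε ≤ σ := by
    have : ε ≤ σ / M := hεε₀.trans (min_le_right _ _)
    rw [le_div_iff₀ hM0] at this
    linarith
  set v : Euc (d + 1) → ℝ := ε⁻¹ • fun x => U x j
  have hv : ∀ x, U x j = ε * v x := fun x => by
    simp only [v, Pi.smul_apply, smul_eq_mul]
    field_simp
  obtain ⟨h, hh0, hhe, hhM, hh1, hh2, hhv⟩ := hM v (by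
    rintro x ⟨hx, hxδ⟩
    exact (hU.visc.harmonic j x (hU.mem_positivitySet hx (hε1.trans_lt hxδ))).const_smul) (by
    intro x hx hxδ
    have h1 := hU.abs_apply_le hx hj
    rw [hv x, abs_mul, abs_of_pos hε] at h1
    exact (mul_le_iff_le_one_right hε).1 h1)
  rw [neg_one_smul] at hhe
  have hin : ∀ (s : ℝ) x, inner ℝ (U x) (EuclideanSpace.single j s) = s * U x j := fun s x => by
    simp [EuclideanSpace.inner_single_right]
  have hup := apply_le_of_approx hU hc hσ hσ1 hε (by linarith)
    (f := EuclideanSpace.single j 1) (fun x hx => by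
      rw [hin, one_mul]; exact (abs_le.1 (hU.abs_apply_le hx hj)).2) hh0 hhe hh1
    (fun x hx hxδ => by
      have h1 := (abs_le.1 (hhv x hx hxδ)).1
      rw [hin, one_mul, hv x]
      exact mul_le_mul_of_nonneg_left (by linarith) hε.le) hM0.le hhM hε3
  have hlo := apply_le_of_approx hU hc hσ hσ1 hε (by linarith)
    (f := EuclideanSpace.single j (-1)) (h := -h) (fun x hx => by
      rw [hin]; linarith [(abs_le.1 (hU.abs_apply_le hx hj)).1]) (by rw [map_neg, hh0, neg_zero])
    (by rw [map_neg, hhe]) (fun x hx => by rw [peval_neg, abs_neg]; exact hh1 x hx)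
    (fun x hx hxδ => by
      have h1 := (abs_le.1 (hhv x hx hxδ)).2
      rw [hin, hv x, peval_neg, ← mul_assoc, neg_one_mul, neg_mul, ← mul_neg]
      exact mul_le_mul_of_nonneg_left (by linarith) hε.le) hM0.le hhM.neg hε3
  obtain ⟨hgrad, htay⟩ := taylor_of_abs_le_two hh0 hh2
  refine ⟨peval (pderiv (Fin.last d) h) 0, hgrad _, fun x hx hxc => ?_⟩
  have hx4 : x ∈ closedBall (0 : Euc (d + 1)) (1 / 4) := by
    rw [mem_closedBall_zero_iff]; linarith
  have hx2 : x ∈ closedBall (0 : Euc (d + 1)) (1 / 2) :=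
    closedBall_subset_closedBall (by norm_num) hx4
  have h1 := htay x hx
  -- Oddness removes h(0) and all tangential derivatives at 0; only the normal one is left.
  rw [peval_eq_zero_of_odd hhe (x := 0) rfl, sub_zero, Finset.sum_eq_single (Fin.last d)
    (fun i _ hi => by rw [pderiv_eq_zero_of_odd hhe hi rfl, zero_mul]) (by simp)] at h1
  have h1 := abs_le.1 h1
  have h2 := hc.le_inside x hx4
  have h3 := hup x hx2 hxc
  have h4 := hlo x hx2 hxc
  rw [hin] at h3 h4
  rw [peval_neg] at h4
  have h5 : ε * (peval h x + peval c x) ≤ ε * (peval (pderiv (Fin.last d) h) 0 * x (Fin.last d) +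
      (64 * (d + 1 : ℝ) ^ 3 * ‖x‖ ^ 2 + κ)) := mul_le_mul_of_nonneg_left (by linarith) hε.le
  have h6 : ε * (-peval h x + peval c x) ≤
      ε * (-(peval (pderiv (Fin.last d) h) 0 * x (Fin.last d)) +
      (64 * (d + 1 : ℝ) ^ 3 * ‖x‖ ^ 2 + κ)) := mul_le_mul_of_nonneg_left (by linarith) hε.le
  rw [abs_le]
  constructor <;> linarith

end

noncomputable section

/-! ### From linear approximation to improved flatness -/

theorem norm_le_card_mul {n : ℕ} {v : Euc n} {B : ℝ} (hB : 0 ≤ B) (h : ∀ i, |v i| ≤ B) :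
    ‖v‖ ≤ n * B := by
  refine abs_le_of_sq_le_sq' ?_ (by positivity) |>.2
  rw [EuclideanSpace.real_norm_sq_eq]
  have h1 : ∑ i, v i ^ 2 ≤ ∑ _i : Fin n, B ^ 2 := Finset.sum_le_sum fun i _ => by
    rw [← sq_abs]; exact pow_le_pow_left₀ (abs_nonneg _) (h i) 2
  rw [Finset.sum_const, Finset.card_univ, Fintype.card_fin, nsmul_eq_mul] at h1
  refine h1.trans ?_
  rw [mul_pow]
  refine mul_le_mul_of_nonneg_right ?_ (sq_nonneg B)
  exact_mod_cast Nat.le_self_pow two_ne_zero n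

/-- Normalization of an orthogonal perturbation of a unit vector. -/
theorem normalize_perturbation {n : ℕ} {e q : Euc n} {ε : ℝ} (hε : 0 ≤ ε) (he : ‖e‖ = 1)
    (hq : inner ℝ e q = 0) :
    1 ≤ ‖e + ε • q‖ ∧ ‖e + ε • q‖ ≤ 1 + ε ^ 2 * ‖q‖ ^ 2 ∧
      ‖‖e + ε • q‖⁻¹ • (e + ε • q)‖ = 1 ∧ ‖‖e + ε • q‖⁻¹ • (e + ε • q) - e‖ ≤ 2 * (ε * ‖q‖) := by
  have hsq : ‖e + ε • q‖ ^ 2 = 1 + ε ^ 2 * ‖q‖ ^ 2 := by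
    rw [norm_add_sq_real, inner_smul_right, hq, he, norm_smul, Real.norm_of_nonneg hε]
    ring
  have h1 : 1 ≤ ‖e + ε • q‖ := by
    rw [← one_le_sq_iff₀ (norm_nonneg _), hsq]
    linarith [(by positivity : 0 ≤ ε ^ 2 * ‖q‖ ^ 2)]
  have h0 : ‖e + ε • q‖ ≠ 0 := by linarith
  have hle : ‖e + ε • q‖ ≤ 1 + ε * ‖q‖ := by
    have := norm_add_le e (ε • q)
    rwa [he, norm_smul, Real.norm_of_nonneg hε] at this
  refine ⟨h1, hsq ▸ le_self_pow₀ h1 two_ne_zero, ?_, ?_⟩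
  · rw [norm_smul, norm_inv, norm_norm, inv_mul_cancel₀ h0]
  · set v := e + ε • q
    have e1 : ‖v‖⁻¹ • v - e = ((1 - ‖v‖) * ‖v‖⁻¹) • v + ε • q := by
      have : (1 - ‖v‖) * ‖v‖⁻¹ = ‖v‖⁻¹ - 1 := by field_simp
      rw [this, sub_smul, one_smul]
      simp only [v]
      abel
    rw [e1]
    refine (norm_add_le _ _).trans ?_
    rw [norm_smul, norm_smul, norm_mul, norm_inv, norm_norm, mul_assoc, inv_mul_cancel₀ h0,
      mul_one, Real.norm_of_nonneg hε, Real.norm_of_nonpos (by linarith)]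
    linarith

/-- The new directions are e_n + εp and f¹ + εc, normalized. Before normalization the error is
estimated component by component; orthogonality of the perturbations makes both lengths 1 + O(ε²),
which accounts for the term 4D²ε in `her`. -/
theorem IsFlatSolution.improve {d k : ℕ} {ε r D e : ℝ} {U : Euc (d + 1) → Euc (k + 1)}
    (hU : IsFlatSolution ε U) (hε : 0 < ε) (hr1 : r ≤ 1) {p : Euc (d + 1)}
    {c : Euc (k + 1)} (hp0 : p (Fin.last d) = 0) (hc0 : c 0 = 0) (hp : ‖p‖ ≤ D) (hc : ‖c‖ ≤ D)
    (hεD : ε * D ≤ 1)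
    (hlow : ∀ x ∈ ball (0 : Euc (d + 1)) r, x (Fin.last d) + ε * (inner ℝ x p - e) ≤ U x 0)
    (hupp : ∀ x ∈ ball (0 : Euc (d + 1)) r, x ∈ closure (positivitySet (ball 0 1) U) →
      ‖U x‖ ≤ x (Fin.last d) + ε * (inner ℝ x p + e))
    (hoth : ∀ j ≠ 0, ∀ x ∈ ball (0 : Euc (d + 1)) r, x ∈ closure (positivitySet (ball 0 1) U) →
      |U x j - ε * (c j * x (Fin.last d))| ≤ ε * e)
    (he : 0 < e) (her : (k + 1) * (2 * e + ε * (D * (1 + D))) + ε * (4 * D ^ 2) ≤ r / 2) :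
    ∃ (ν : Euc (d + 1)) (fbar : Euc (k + 1)), ‖ν‖ = 1 ∧ ‖fbar‖ = 1 ∧
      ‖ν - eLast d‖ ≤ 2 * D * ε ∧ ‖fbar - fFirst k‖ ≤ 2 * D * ε ∧
      (∀ x ∈ ball (0 : Euc (d + 1)) r, ‖U x - max (inner ℝ x ν) 0 • fbar‖ ≤ ε * (r / 2)) ∧
      (∀ x ∈ ball (0 : Euc (d + 1)) r, inner ℝ x ν < -(ε * (r / 2)) → ‖U x‖ = 0) := by
  have hD : 0 ≤ D := (norm_nonneg p).trans hp
  obtain ⟨hν1, hν2, hν3, hν4⟩ := normalize_perturbation hε.le (e := eLast d) (q := p)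
    (by simp [eLast]) (by simp [eLast, EuclideanSpace.inner_single_left, hp0])
  obtain ⟨hf1, hf2, hf3, hf4⟩ := normalize_perturbation hε.le (e := fFirst k) (q := c)
    (by simp [fFirst]) (by simp [fFirst, EuclideanSpace.inner_single_left, hc0])
  set N := ‖eLast d + ε • p‖
  set N' := ‖fFirst k + ε • c‖
  have hN0 : 0 < N := by linarith
  have hp2 : ε ^ 2 * ‖p‖ ^ 2 ≤ ε ^ 2 * D ^ 2 := by gcongr
  have hc2 : ε ^ 2 * ‖c‖ ^ 2 ≤ ε ^ 2 * D ^ 2 := by gcongr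
  have hεp : ε * ‖p‖ ≤ ε * D := by gcongr
  have hεc : ε * ‖c‖ ≤ ε * D := by gcongr
  have hℓ : ∀ x : Euc (d + 1), inner ℝ x (N⁻¹ • (eLast d + ε • p)) =
      N⁻¹ * (x (Fin.last d) + ε * inner ℝ x p) := fun x => by
    rw [inner_smul_right, inner_add_right, inner_smul_right]
    simp [eLast, EuclideanSpace.inner_single_right]
  have hsmall : e ≤ r / 2 := by
    have h1 : 0 ≤ ε * (D * (1 + D)) := by positivity
    have h2 : 0 ≤ ε * (4 * D ^ 2) := by positivity
    have h3 : (1 : ℝ) ≤ k + 1 := by linarith [(Nat.cast_nonneg k : (0 : ℝ) ≤ k)]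
    have h4 : 2 * e + ε * (D * (1 + D)) ≤ (k + 1) * (2 * e + ε * (D * (1 + D))) :=
      le_mul_of_one_le_left (by linarith) h3
    linarith
  have hball : ball (0 : Euc (d + 1)) r ⊆ ball 0 1 := ball_subset_ball hr1
  refine ⟨N⁻¹ • (eLast d + ε • p), N'⁻¹ • (fFirst k + ε • c), hν3, hf3, by linarith, by linarith,
    fun x hx => ?_, fun x hx hlt => ?_⟩
  · set ℓ := x (Fin.last d) + ε * inner ℝ x p
    have hx1 : ‖x‖ ≤ 1 := (mem_ball_zero_iff.1 (hball hx)).le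
    have hxp : |inner ℝ x p| ≤ D := by
      refine (abs_real_inner_le_norm x p).trans ?_
      calc ‖x‖ * ‖p‖ ≤ 1 * D := by gcongr
        _ = D := one_mul D
    have hxp1 : ε * inner ℝ x p ≤ ε * D :=
      mul_le_mul_of_nonneg_left (abs_le.1 hxp).2 hε.le
    have hxp2 : ε * -D ≤ ε * inner ℝ x p :=
      mul_le_mul_of_nonneg_left (abs_le.1 hxp).1 hε.le
    have hxn : x (Fin.last d) ≤ 1 := (le_abs_self _).trans ((abs_coord_le x _).trans hx1)
    have hℓ0 : 0 ≤ max ℓ 0 := le_max_right _ _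
    have hℓ2 : max ℓ 0 ≤ 2 := max_le (by simp only [ℓ]; linarith) (by norm_num)
    have hlowx := hlow x hx
    have hεe : 0 < ε * e := mul_pos hε he
    have hoff : x ∉ closure (positivitySet (ball 0 1) U) → U x = 0 := fun hxc =>
      eq_zero_of_notMem_positivitySet (hball hx) fun h => hxc (subset_closure h)
    -- The bounds from above hold only on the closure of Ω(U). Off it U = 0, and then ℓ⁺ is small:
    -- by the lower bound on u¹ for the first component, and for the others because x_n ≤ ε there.
    have hcomp : ∀ j, |(U x - max ℓ 0 • (fFirst k + ε • c)) j| ≤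
        ε * (2 * e + ε * (D * (1 + D))) := by
      intro j
      have hpos : 0 ≤ ε * (ε * (D * (1 + D))) := by positivity
      by_cases hj : j = 0
      · subst hj
        have e1 : (U x - max ℓ 0 • (fFirst k + ε • c)) 0 = U x 0 - max ℓ 0 := by
          simp [fFirst, hc0]
        rw [e1]
        by_cases hxc : x ∈ closure (positivitySet (ball 0 1) U)
        · have h1 := hupp x hx hxc
          have h2 := (le_abs_self (U x 0)).trans (abs_coord_le (U x) 0)
          have h3 := norm_nonneg (U x)
          have h4 : ℓ ≤ max ℓ 0 := le_max_left _ _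
          have h5 : max ℓ 0 ≤ ℓ + ε * e := max_le (by linarith) (by simp only [ℓ]; linarith)
          refine abs_le.2 ⟨?_, ?_⟩ <;> simp only [ℓ] at * <;> linarith
        · rw [hoff hxc, PiLp.zero_apply] at hlowx ⊢
          have h5 : max ℓ 0 ≤ ε * e := max_le (by simp only [ℓ]; linarith) hεe.le
          refine abs_le.2 ⟨?_, ?_⟩ <;> linarith
      · have e1 : (U x - max ℓ 0 • (fFirst k + ε • c)) j = U x j - ε * (c j * max ℓ 0) := by
          simp [fFirst, hj]; ring
        have hcj : |c j| ≤ D := (abs_coord_le c j).trans hc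
        rw [e1]
        by_cases hxc : x ∈ closure (positivitySet (ball 0 1) U)
        · have h1 := hU.neg_le_of_mem_closure hxc
          have h2 : |x (Fin.last d) - max ℓ 0| ≤ ε * (1 + D) := by
            refine abs_le.2 ⟨?_, ?_⟩
            · have : max ℓ 0 ≤ x (Fin.last d) + ε * (1 + D) :=
                max_le (by simp only [ℓ]; linarith) (by linarith [mul_nonneg hε.le hD])
              linarith
            · have : ℓ ≤ max ℓ 0 := le_max_left _ _
              simp only [ℓ] at this
              linarith
          have h3 : |c j * (x (Fin.last d) - max ℓ 0)| ≤ D * (ε * (1 + D)) := by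
            rw [abs_mul]; gcongr
          have h4 : U x j - ε * (c j * max ℓ 0) = (U x j - ε * (c j * x (Fin.last d))) +
              ε * (c j * (x (Fin.last d) - max ℓ 0)) := by ring
          rw [h4]
          refine (abs_add_le _ _).trans ((add_le_add (hoth j hj x hx hxc) ?_).trans
            (b := ε * e + ε * (D * (ε * (1 + D)))) (by linarith))
          rw [abs_mul, abs_of_pos hε]
          gcongr
        · have h1 : x (Fin.last d) ≤ ε := by
            by_contra! h
            exact hxc (subset_closure (hU.mem_positivitySet (hball hx) h))
          have h2 : max ℓ 0 ≤ ε * (1 + D) :=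
            max_le (by simp only [ℓ]; linarith) (by positivity)
          rw [hoff hxc, PiLp.zero_apply, zero_sub, abs_neg, abs_mul, abs_mul, abs_of_pos hε,
            abs_of_nonneg hℓ0]
          have h3 : |c j| * max ℓ 0 ≤ D * (ε * (1 + D)) := by gcongr
          have h4 := mul_le_mul_of_nonneg_left h3 hε.le
          linarith
    have hsum := norm_le_card_mul (by positivity) hcomp
    push_cast at hsum
    have hmax : max (inner ℝ x (N⁻¹ • (eLast d + ε • p))) 0 = N⁻¹ * max ℓ 0 := by
      rw [hℓ, mul_max_of_nonneg _ _ (inv_nonneg.2 hN0.le), mul_zero]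
    -- The normalization error is a multiple of the unit vector f̄ with coefficient (N' - N⁻¹)ℓ⁺,
    -- where N' - N⁻¹ = O(ε²).
    have hdec : U x - max (inner ℝ x (N⁻¹ • (eLast d + ε • p))) 0 • N'⁻¹ • (fFirst k + ε • c) =
        (U x - max ℓ 0 • (fFirst k + ε • c)) +
          ((N' - N⁻¹) * max ℓ 0) • N'⁻¹ • (fFirst k + ε • c) := by
      have h0 : N' * N'⁻¹ = 1 := mul_inv_cancel₀ (by linarith)
      have h1 : max ℓ 0 • (fFirst k + ε • c) =
          (N' * max ℓ 0) • N'⁻¹ • (fFirst k + ε • c) := by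
        rw [smul_smul, mul_right_comm, h0, one_mul]
      rw [hmax, h1, sub_mul, sub_smul]
      abel
    have hdiff : |N' - N⁻¹| ≤ 2 * (ε ^ 2 * D ^ 2) := by
      have h1 : N⁻¹ ≤ 1 := inv_le_one_of_one_le₀ hν1
      have h2 : 2 - N ≤ N⁻¹ := by
        rw [← one_div, le_div_iff₀ hN0]
        nlinarith [sq_nonneg (N - 1)]
      rw [abs_of_nonneg (by linarith)]
      linarith
    rw [hdec]
    refine (norm_add_le _ _).trans ?_
    rw [norm_smul, hf3, mul_one, norm_mul, Real.norm_eq_abs, Real.norm_of_nonneg hℓ0]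
    have h1 : |N' - N⁻¹| * max ℓ 0 ≤ 2 * (ε ^ 2 * D ^ 2) * 2 := by gcongr
    have h2 := mul_le_mul_of_nonneg_left her hε.le
    linarith
  · rw [hℓ] at hlt
    by_contra hne
    have hxc : x ∈ closure (positivitySet (ball 0 1) U) :=
      subset_closure ⟨hball hx, lt_of_le_of_ne (norm_nonneg _) (Ne.symm hne)⟩
    have h1 := hupp x hx hxc
    have h2 := norm_nonneg (U x)
    have h3 := mul_le_mul_of_nonneg_left hsmall hε.le
    have h4 : -(ε * (r / 2)) ≤ x (Fin.last d) + ε * inner ℝ x p := by linarith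
    have h5 : N⁻¹ * (x (Fin.last d) + ε * inner ℝ x p) < 0 :=
      hlt.trans_le (by linarith [mul_pos hε he])
    have h6 : x (Fin.last d) + ε * inner ℝ x p < 0 :=
      (pos_iff_neg_of_mul_neg h5).1 (inv_pos.2 hN0)
    have h7 := mul_le_mul_of_nonpos_right (inv_le_one_of_one_le₀ hν1) h6.le
    linarith

end

/-- Improvement of flatness, in dimensions `n = d + 1 ≥ 1` and `m = k + 1 ≥ 1`. -/
theorem mainTheorem2 (d k : ℕ) :
    ∃ r₀ : ℝ, 0 < r₀ ∧ ∃ C : ℝ, 0 < C ∧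
      ∀ r : ℝ, 0 < r → r ≤ r₀ →
        ∃ ε₀ : ℝ, 0 < ε₀ ∧ ∀ ε : ℝ, 0 < ε → ε ≤ ε₀ →
          ∀ U : Euc (d + 1) → Euc (k + 1),
            IsViscositySolution (Metric.ball 0 1) U →
            (∀ x ∈ Metric.ball (0 : Euc (d + 1)) 1,
              ‖U x - max (x (Fin.last d)) 0 • fFirst k‖ ≤ ε) →
            (∀ x ∈ Metric.ball (0 : Euc (d + 1)) 1, x (Fin.last d) < -ε → ‖U x‖ = 0) →
            (0 : Euc (d + 1)) ∈ freeBoundary (Metric.ball 0 1) U →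
            ∃ (ν : Euc (d + 1)) (fbar : Euc (k + 1)),
              ‖ν‖ = 1 ∧ ‖fbar‖ = 1 ∧
              ‖ν - eLast d‖ ≤ C * ε ∧ ‖fbar - fFirst k‖ ≤ C * ε ∧
              (∀ x ∈ Metric.ball (0 : Euc (d + 1)) r,
                ‖U x - max (inner ℝ x ν) 0 • fbar‖ ≤ ε * (r / 2)) ∧
              (∀ x ∈ Metric.ball (0 : Euc (d + 1)) r,
                inner ℝ x ν < -(ε * (r / 2)) → ‖U x‖ = 0) := by
  set A : ℝ := 64 * (d + 1 : ℝ) ^ 3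
  have hA : 0 < A := by positivity
  set D : ℝ := (d + 1) * A + (k + 1) * A
  have hD : 0 < D := by positivity
  -- The bound 1/8 is the range of the Taylor expansion; the other bound makes A r² at most
  -- r/(16(k+1)), half of the error `e` below.
  refine ⟨min (1 / 8) (1 / (16 * (k + 1) * A)), by positivity, 2 * D, by positivity,
    fun r hr hrr => ?_⟩
  have hr8 : r ≤ 1 / 8 := hrr.trans (min_le_left _ _)
  have hrA : A * r ^ 2 ≤ r / (16 * (k + 1)) := by
    have h1 : r ≤ 1 / (16 * (k + 1) * A) := hrr.trans (min_le_right _ _)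
    rw [le_div_iff₀ (by positivity)] at h1 ⊢
    have := mul_le_mul_of_nonneg_left h1 hr.le
    linarith
  obtain ⟨ε₁, hε₁, H₁⟩ := exists_linear_approx_first d k
    (by positivity : 0 < r / (16 * (k + 1)))
  obtain ⟨ε₂, hε₂, H₂⟩ := exists_linear_approx_other d k
    (by positivity : 0 < r / (16 * (k + 1)))
  set K : ℝ := (k + 1) * (D * (1 + D)) + 4 * D ^ 2
  have hK : 0 < K := by positivity
  refine ⟨min (min ε₁ ε₂) (min (1 / D) (r / (4 * K))), by positivity,
    fun ε hε hεε U hvisc hflat hzero horigin => ?_⟩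
  have hεD : ε * D ≤ 1 := by
    have : ε ≤ 1 / D := hεε.trans ((min_le_right _ _).trans (min_le_left _ _))
    rwa [le_div_iff₀ hD] at this
  have hεK : ε * K ≤ r / 4 := by
    have : ε ≤ r / (4 * K) := hεε.trans ((min_le_right _ _).trans (min_le_right _ _))
    rw [le_div_iff₀ (by positivity)] at this
    linarith
  have hU : IsFlatSolution ε U := ⟨hvisc, hflat, hzero, horigin⟩
  obtain ⟨p, hp0, hpA, hp⟩ := H₁ ε hε (hεε.trans ((min_le_left _ _).trans (min_le_left _ _))) U hU
  choose a haA ha using H₂ ε hε (hεε.trans ((min_le_left _ _).trans (min_le_right _ _))) U hU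
  set c : Euc (k + 1) := WithLp.toLp 2 fun j => if hj : j = 0 then 0 else a j hj
  have hc : ∀ j (hj : j ≠ 0), c j = a j hj := fun j hj => by simp [c, hj]
  have hpD : ‖p‖ ≤ D := by
    have := norm_le_card_mul hA.le hpA
    push_cast at this
    exact this.trans (le_add_of_nonneg_right (by positivity))
  have hcD : ‖c‖ ≤ D := by
    have := norm_le_card_mul (v := c) hA.le fun j => by
      by_cases hj : j = 0
      · simpa [c, hj] using hA.le
      · rw [hc j hj]; exact haA j hj
    push_cast at this
    exact this.trans (le_add_of_nonneg_left (by positivity))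
  -- With this value (k+1)·2e = r/4, and the remaining terms εK are at most r/4, which gives r/2 in
  -- total.
  set e : ℝ := r / (8 * (k + 1))
  have hx8 : ∀ x ∈ ball (0 : Euc (d + 1)) r,
      ‖x‖ ≤ 1 / 8 ∧ A * ‖x‖ ^ 2 + r / (16 * (k + 1)) ≤ e := fun x hx => by
    have hxr : ‖x‖ ≤ r := (mem_ball_zero_iff.1 hx).le
    refine ⟨hxr.trans hr8, ?_⟩
    have h1 : A * ‖x‖ ^ 2 ≤ A * r ^ 2 := by gcongr
    have h2 : e = r / (16 * (k + 1)) + r / (16 * (k + 1)) := by simp only [e]; field_simp; ring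
    linarith
  refine hU.improve hε (hr8.trans (by norm_num)) hp0 (by simp [c]) hpD hcD hεD (e := e)
    (fun x hx => ?_) (fun x hx hxc => ?_) (fun j hj x hx hxc => ?_) (by positivity) ?_
  · obtain ⟨h1, h2⟩ := hx8 x hx
    refine le_trans ?_ (hp x h1).1
    have := mul_le_mul_of_nonneg_left h2 hε.le
    linarith
  · obtain ⟨h1, h2⟩ := hx8 x hx
    refine ((hp x h1).2 hxc).trans ?_
    have := mul_le_mul_of_nonneg_left h2 hε.le
    linarith
  · obtain ⟨h1, h2⟩ := hx8 x hx
    rw [hc j hj]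
    exact (ha j hj x h1 hxc).trans (mul_le_mul_of_nonneg_left h2 hε.le)
  · have h1 : (k + 1) * e = r / 8 := by simp only [e]; field_simp
    simp only [K] at hεK
    linarith
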